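/- Let $\mu$ be a $\sigma$-finite measure on a measurable space, $\Theta\subset\mathbb R$ open, $\theta_0\in\Theta$, and let $X_1,X_2,\dots$ be independent observations such that, under $\theta\in\Theta$, $X_j$ has a density $f_{\theta,j}$ with respect to $\mu$. Write $f_\theta^n(x_1,\dots,x_n)=\prod_{j=1}^n f_{\theta,j}(x_j)$, let $\mu^n$ be the $n$-fold product measure, and let $E_{\theta}$ be the expectation under $\theta$ (integrands being irrelevant where the density vanishes). Assume: 1. there are $\delta>0$ and $0<\gamma_1<\infty$ such that $E_{\theta_0}\ln\frac{f_{\theta_0,j}(X_j)}{f_{\theta,j}(X_j)}\le\gamma_1(\theta-\theta_0)^2$ for all $j\ge1$ and all $\theta\in\Theta$ with $|\theta-\theta_0|\le\delta$; 2. for every $j\ge 1$ there is a $\mu$-integrable function $\dot f_{\theta_0,j}$ with $\int|f_{\theta,j}-f_{\theta_0,j}-(\theta-\theta_0)\dot f_{\theta_0,j}|\,d\mu=o(\theta-\theta_0)$ as $\theta\to\theta_0$; 3. there is $0<\gamma_2<\infty$ such that $E_{\theta_0}|q_j(X_j)|\le\gamma_2$ for all $j\ge1$, where $q_j=\dot f_{\theta_0,j}/f_{\theta_0,j}$.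 A (randomized) stopping rule is a sequence $\psi=(\psi_1,\psi_2,\dots)$ of measurable functions $\psi_n=\psi_n(x_1,\dots,x_n)$ with values in $[0,1]$. Put $t_n^\psi=(1-\psi_1)\cdots(1-\psi_{n-1})$ (with $t_1^\psi\equiv 1$), $s_n^\psi=t_n^\psi\psi_n$, and $T_n^\psi=\{t_n^\psi>0\}$; the stopping time $\tau_\psi$ has $P_{\theta}(\tau_\psi=n)=E_\theta s_n^\psi$. Let $E_{\theta_0}\tau_\psi=\sum_{n\ge1} nP_{\theta_0}(\tau_\psi=n)$ if $\sum_{n\ge1} P_{\theta_0}(\tau_\psi=n)=1$ and $E_{\theta_0}\tau_\psi=\infty$ otherwise, and let $\mathscr F=\{\psi: E_{\theta_0}\tau_\psi<\infty\}$. Let $b\in\mathbb R$ and $c>0$, $g(z)=\min\{0,z\}$, $z_n=\sum_{i=1}^n q_i(x_i)$ (and $z_n=0$ where $f^n_{\theta_0}=0$), and for $\psi\in\mathscr F$ $$L(\psi;b,c)=\sum_{n=1}^\infty E_{\theta_0}s_n^\psi\,(nc+g(b-z_n)).$$ For $N\ge1$ let $v_N^N(z;c)=g(z)$ and, for $n=N,N-1,\dots,1$,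 $r_{n-1}^N(z;c)=E_{\theta_0}v_n^N(z-q_n(X_n);c)$ and $v_{n-1}^N(z;c)=\min\{g(z),\,c+r_{n-1}^N(z;c)\}$. Let $r_n(z;c)=\lim_{N\to\infty}r_n^N(z;c)$. Then a stopping rule $\psi\in\mathscr F$ satisfies $L(\psi;b,c)=\inf_{\psi'\in\mathscr F}L(\psi';b,c)$ if and only if, for every $n\ge1$, $$I_{\{g(b-z_n)<c+r_n(b-z_n;c)\}}\le\psi_n\le I_{\{g(b-z_n)\le c+r_n(b-z_n;c)\}}$$ $\mu^n$-almost everywhere on $T_n^\psi\cap\{f_{\theta_0}^n>0\}$. -/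

import Mathlib

open MeasureTheory Filter Topology
open scoped ENNReal

namespace SeqTest

noncomputable section

variable {X : Type*} [MeasurableSpace X]

/-- `f θ j` is, for each `θ ∈ Θ`, a probability density with respect to `μ`; it is the density of
the `(j+1)`-st observation (observations are listed from index `0`). -/
structure IsDensityFamily (μ : Measure X) (Θ : Set ℝ) (f : ℝ → ℕ → X → ℝ) : Prop where
  measurable : ∀ θ ∈ Θ, ∀ j, Measurable (f θ j)
  nonneg : ∀ θ ∈ Θ, ∀ j x, 0 ≤ f θ j x
  lintegral_eq_one : ∀ θ ∈ Θ, ∀ j, ∫⁻ x, ENNReal.ofReal (f θ j x) ∂μ = 1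

/-- The distribution with density `p` with respect to `μ`. -/
def law (μ : Measure X) (p : X → ℝ) : Measure X :=
  μ.withDensity fun x => ENNReal.ofReal (p x)

/-- Kullback-Leibler information of one observation for distinguishing `θ₀` from `θ₁`:
the expectation under `θ₀` of the logarithm of the density ratio, with values in `[0, ∞]`. -/
def klInfo (μ : Measure X) (f : ℝ → ℕ → X → ℝ) (j : ℕ) (θ₀ θ₁ : ℝ) : ℝ≥0∞ :=
  InformationTheory.klDiv (law μ (f θ₀ j)) (law μ (f θ₁ j))

/-- The information of one observation is at most quadratic in `θ - θ₀` near `θ₀`,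
uniformly over the observations. -/
def KLQuadraticBound (μ : Measure X) (Θ : Set ℝ) (f : ℝ → ℕ → X → ℝ) (θ₀ : ℝ) : Prop :=
  ∃ δ > (0 : ℝ), ∃ γ₁ > (0 : ℝ), ∀ j, ∀ θ ∈ Θ, |θ - θ₀| ≤ δ →
    klInfo μ f j θ₀ θ ≤ ENNReal.ofReal (γ₁ * (θ - θ₀) ^ 2)

/-- Each marginal density is Fréchet differentiable in `L¹(μ)` at `θ₀`, with derivative
`fdot j`. -/
def L1Differentiable (μ : Measure X) (f : ℝ → ℕ → X → ℝ) (θ₀ : ℝ) (fdot : ℕ → X → ℝ) : Prop :=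
  ∀ j, Integrable (fdot j) μ ∧
    (fun θ => ∫ x, |f θ j x - f θ₀ j x - (θ - θ₀) * fdot j x| ∂μ) =o[𝓝 θ₀] fun θ => θ - θ₀

/-- The score `q` of one observation, `p` being the sequence of null densities. -/
def score (p fdot : ℕ → X → ℝ) (j : ℕ) (x : X) : ℝ := fdot j x / p j x

/-- The scores have uniformly bounded first absolute moments under the null densities `p`. -/
def ScoreMomentBound (μ : Measure X) (p fdot : ℕ → X → ℝ) : Prop :=
  ∃ γ₂ > (0 : ℝ), ∀ j,
    ∫⁻ x, ENNReal.ofReal (|score p fdot j x| * p j x) ∂μ ≤ ENNReal.ofReal γ₂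

/-- The `n`-fold product measure. -/
def prodMeasure (μ : Measure X) (n : ℕ) : Measure (Fin n → X) := Measure.pi fun _ => μ

/-- Joint density of the first `n` (independent) observations with respect to the product
measure. -/
def jointDensity (p : ℕ → X → ℝ) (n : ℕ) (x : Fin n → X) : ℝ := ∏ i : Fin n, p i (x i)

/-- Expectation of a function of the first `n` observations. -/
def expect (μ : Measure X) (p : ℕ → X → ℝ) (n : ℕ) (F : (Fin n → X) → ℝ) : ℝ :=
  ∫ x, F x * jointDensity p n x ∂(prodMeasure μ n)

variable (X) in
/-- A randomized stopping rule: `prob n x` is the conditional probability of stopping at stage `n`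
after the observations `x`. At least one observation is taken, so stage `0` has probability `0`. -/
structure StoppingRule where
  prob : (n : ℕ) → (Fin n → X) → ℝ
  measurable : ∀ n, Measurable (prob n)
  nonneg : ∀ n x, 0 ≤ prob n x
  le_one : ∀ n x, prob n x ≤ 1
  prob_zero : ∀ x, prob 0 x = 0

/-- `tₙ = (1 - ψ₁) ⋯ (1 - ψₙ₋₁)`; the factor of stage `0` equals `1`. -/
def StoppingRule.t (ψ : StoppingRule X) (n : ℕ) (x : Fin n → X) : ℝ :=
  ∏ k : Fin n, (1 - ψ.prob k fun i => x (Fin.castLE k.isLt.le i))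

/-- `sₙ = (1 - ψ₁) ⋯ (1 - ψₙ₋₁) ψₙ`; in particular `s₀ = 0`. -/
def StoppingRule.s (ψ : StoppingRule X) (n : ℕ) (x : Fin n → X) : ℝ :=
  ψ.t n x * ψ.prob n x

/-- `Tₙ`: the samples after which stage `n` is reached with positive probability. -/
def StoppingRule.T (ψ : StoppingRule X) (n : ℕ) : Set (Fin n → X) := {x | 0 < ψ.t n x}

/-- The probability `E sₙ` that the stopping time equals `n`. -/
def stopProb (μ : Measure X) (p : ℕ → X → ℝ) (ψ : StoppingRule X) (n : ℕ) : ℝ≥0∞ :=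
  ∫⁻ x, ENNReal.ofReal (ψ.s n x * jointDensity p n x) ∂(prodMeasure μ n)

/-- The average sample number: infinite unless the stopping time is almost surely finite. -/
def asn (μ : Measure X) (p : ℕ → X → ℝ) (ψ : StoppingRule X) : ℝ≥0∞ :=
  if ∑' n, stopProb μ p ψ n = 1 then ∑' n : ℕ, (n : ℝ≥0∞) * stopProb μ p ψ n else ∞

/-- The stopping rules with finite average sample number under the densities `p`. -/
def finiteASN (μ : Measure X) (p : ℕ → X → ℝ) : Set (StoppingRule X) := {ψ | asn μ p ψ < ∞}

/-- `g z = min {0, z}`. -/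
def g (z : ℝ) : ℝ := min 0 z

/-- The Lagrange-multiplier function
`L(ψ; b, c) = ∑ₙ E sₙ (n c + min {0, b - (q₁ + ⋯ + qₙ)})`
(the term `n = 0` vanishes since `s₀ = 0`). -/
def lagrangian (μ : Measure X) (p fdot : ℕ → X → ℝ) (b c : ℝ) (ψ : StoppingRule X) : ℝ :=
  ∑' n : ℕ, expect μ p n fun x =>
    ψ.s n x * (n * c + g (b - ∑ i : Fin n, score p fdot i (x i)))

/-- `zₙ = q₁ + ⋯ + qₙ`, set to `0` where the joint density vanishes. -/
def zStat (p fdot : ℕ → X → ℝ) (n : ℕ) (x : Fin n → X) : ℝ :=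
  if jointDensity p n x = 0 then 0 else ∑ i : Fin n, score p fdot i (x i)

/-- Backward recursion with `k` stages left after `n` observations:
`k = 0` gives `g`, and `k + 1` gives `min {g z, c + E w(k, n + 1, z - q)}`, where `q` is the score
of the `(n+1)`-st observation. -/
def backward (μ : Measure X) (p fdot : ℕ → X → ℝ) (c : ℝ) : ℕ → ℕ → ℝ → ℝ
  | 0, _, z => g z
  | k + 1, n, z =>
      min (g z) (c + ∫ x, backward μ p fdot c k (n + 1) (z - score p fdot n x) * p n x ∂μ)

/-- `vₙᴺ(z; c)`, for `n ≤ N`. -/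
def vTrunc (μ : Measure X) (p fdot : ℕ → X → ℝ) (c : ℝ) (N n : ℕ) (z : ℝ) : ℝ :=
  backward μ p fdot c (N - n) n z

/-- `rₙᴺ(z; c) = E vₙ₊₁ᴺ(z - qₙ₊₁; c)`, for `n < N`. -/
def rTrunc (μ : Measure X) (p fdot : ℕ → X → ℝ) (c : ℝ) (N n : ℕ) (z : ℝ) : ℝ :=
  ∫ x, vTrunc μ p fdot c N (n + 1) (z - score p fdot n x) * p n x ∂μ

/-- `rₙ(z; c) = lim rₙᴺ(z; c)` as `N → ∞`, a limit (finite or not) in the extended reals. -/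
def r (μ : Measure X) (p fdot : ℕ → X → ℝ) (c : ℝ) (n : ℕ) (z : ℝ) : EReal :=
  limUnder atTop fun N : ℕ => (rTrunc μ p fdot c N n z : EReal)

/-- Samples at which `g(b - zₙ) < c + rₙ(b - zₙ; c)`. -/
def mustStop (μ : Measure X) (p fdot : ℕ → X → ℝ) (b c : ℝ) (n : ℕ) : Set (Fin n → X) :=
  {x | (g (b - zStat p fdot n x) : EReal) <
    (c : EReal) + r μ p fdot c n (b - zStat p fdot n x)}

/-- Samples at which `g(b - zₙ) ≤ c + rₙ(b - zₙ; c)`. -/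
def mayStop (μ : Measure X) (p fdot : ℕ → X → ℝ) (b c : ℝ) (n : ℕ) : Set (Fin n → X) :=
  {x | (g (b - zStat p fdot n x) : EReal) ≤
    (c : EReal) + r μ p fdot c n (b - zStat p fdot n x)}

end

end SeqTest

/-! The regularity assumptions reduce the theorem to stopping a sum of independent centred scores
with second moments at most K = 4γ₁. Quadratic control of the Kullback-Leibler information controls
squared Hellinger distances, and Fatou's lemma turns this into the Fisher information bound
(`lintegral_sq_div_le`). Centring comes from differentiating total mass one in L¹
(`integral_deriv`).

For such scores the cost c per observation beats the quadratic drift, so the truncated value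
functions are bounded below uniformly in the horizon (`exists_neg_sub_abs_le_truncVal`). They
decrease to a limit `val`, which satisfies the untruncated optimality equation (`val_eq_min`).

Any rule is then compared with `val` stage by stage. Define the regret of a decision as its
conditional cost minus the best achievable one; it is nonnegative, and telescoping gives
`sum_halt_gain_add`. If the mean sample size is finite, the second moment of the sum at min(τ, N)
stays bounded, the remainder `meanVal` tends to zero, and the cost equals a constant plus the total
mean regret (`payoff_eq`). The first observation is compulsory, so the regret at stage 0 is common
to all rules. The rule with no later regret has finite mean sample size
(`summable_reach_optimalRule`). Hence a rule is optimal exactly when its regret vanishes almost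
surely at every stage n ≥ 1 that it reaches, which is the indicator sandwich. -/

namespace SeqTest

/-! ### Value functions of the truncated and untruncated stopping problems. -/

section ValueFunctions

variable {X : Type*} [MeasurableSpace X]

lemma g_nonpos (z : ℝ) : g z ≤ 0 := min_le_left _ _

lemma g_abs_sub_le (z w : ℝ) : |g z - g w| ≤ |z - w| := by
  have h := abs_min_sub_min_le_max 0 z 0 w
  simpa [g] using h

/-- Being 1-Lipschitz is the regularity carried through the recursion: it supplies measurability,
integrability along the scores, and linear growth at once. -/
lemma continuous_of_abs_sub_le {F : ℝ → ℝ} (hF : ∀ z w, |F z - F w| ≤ |z - w|) :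
    Continuous F :=
  (LipschitzWith.of_dist_le_mul (K := 1) fun z w => by
    simpa [Real.dist_eq] using hF z w).continuous

lemma abs_le_of_abs_sub_le {F : ℝ → ℝ} (hF : ∀ z w, |F z - F w| ≤ |z - w|) (z : ℝ) :
    |F z| ≤ |F 0| + |z| := by
  have h := hF z 0
  have h' := abs_sub_abs_le_abs_sub (F z) (F 0)
  rw [sub_zero] at h
  linarith

lemma integrable_comp_of_abs_sub_le {Y : Type*} [MeasurableSpace Y] {m : Measure Y}
    [IsFiniteMeasure m] {F : ℝ → ℝ} (hF : ∀ z w, |F z - F w| ≤ |z - w|) {u : Y → ℝ}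
    (hu : Integrable u m) : Integrable (fun y => F (u y)) m := by
  refine Integrable.mono' ((integrable_const |F 0|).add hu.abs)
    ((continuous_of_abs_sub_le hF).comp_aestronglyMeasurable hu.1) ?_
  exact ae_of_all _ fun y => by simpa using abs_le_of_abs_sub_le hF (u y)

/-- Independent centred scores `q n` with laws governed by `ν n` and second moments at most `K`. -/
structure IsScoreSeq (ν : ℕ → Measure X) (q : ℕ → X → ℝ) (K : ℝ) : Prop where
  isProb : ∀ n, IsProbabilityMeasure (ν n)
  measurable : ∀ n, Measurable (q n)
  memLp : ∀ n, MemLp (q n) 2 (ν n)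
  mean : ∀ n, ∫ x, q n x ∂ν n = 0
  sq_le : ∀ n, ∫ x, q n x ^ 2 ∂ν n ≤ K

/-- Value of the stopping problem with at most `k` further observations after stage `n`. -/
noncomputable def truncVal (ν : ℕ → Measure X) (q : ℕ → X → ℝ) (c : ℝ) : ℕ → ℕ → ℝ → ℝ
  | 0, _, z => g z
  | k + 1, n, z => min (g z) (c + ∫ x, truncVal ν q c k (n + 1) (z - q n x) ∂ν n)

/-- Value of the stopping problem without truncation, after stage `n`. -/
noncomputable def val (ν : ℕ → Measure X) (q : ℕ → X → ℝ) (c : ℝ) (n : ℕ) (z : ℝ) : ℝ :=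
  ⨅ k, truncVal ν q c k n z

/-- Expected value of taking one more observation after stage `n`, sampling cost excluded. -/
noncomputable def contVal (ν : ℕ → Measure X) (q : ℕ → X → ℝ) (c : ℝ) (n : ℕ) (z : ℝ) : ℝ :=
  ∫ x, val ν q c (n + 1) (z - q n x) ∂ν n

variable {ν : ℕ → Measure X} {q : ℕ → X → ℝ} {K c : ℝ}

namespace IsScoreSeq

lemma integrable (h : IsScoreSeq ν q K) (n : ℕ) : Integrable (q n) (ν n) := by
  have := h.isProb n
  exact (h.memLp n).integrable (by norm_num)

lemma integrable_sub (h : IsScoreSeq ν q K) (n : ℕ) (z : ℝ) :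
    Integrable (fun x => z - q n x) (ν n) := by
  have := h.isProb n
  exact (integrable_const z).sub (h.integrable n)

lemma integrable_comp (h : IsScoreSeq ν q K) {F : ℝ → ℝ} (hF : ∀ z w, |F z - F w| ≤ |z - w|)
    (n : ℕ) (z : ℝ) : Integrable (fun x => F (z - q n x)) (ν n) := by
  have := h.isProb n
  exact integrable_comp_of_abs_sub_le hF (h.integrable_sub n z)

lemma integral_sub_sq (h : IsScoreSeq ν q K) (n : ℕ) (z : ℝ) :
    ∫ x, (z - q n x) ^ 2 ∂ν n = z ^ 2 + ∫ x, q n x ^ 2 ∂ν n := by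
  have := h.isProb n
  have h1 := h.integrable n
  have h2 : Integrable (fun x => q n x ^ 2) (ν n) := (h.memLp n).integrable_sq
  have hi : Integrable (fun x => z ^ 2 - 2 * z * q n x) (ν n) :=
    (integrable_const _).sub (h1.const_mul _)
  have hsq : ∀ x, (z - q n x) ^ 2 = (z ^ 2 - 2 * z * q n x) + q n x ^ 2 := fun x => by ring
  simp_rw [hsq]
  rw [integral_add hi h2, integral_sub (integrable_const _) (h1.const_mul _),
    integral_const_mul, h.mean n]
  simp

lemma integrable_sub_sq (h : IsScoreSeq ν q K) (n : ℕ) (z : ℝ) :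
    Integrable (fun x => (z - q n x) ^ 2) (ν n) := by
  have := h.isProb n
  exact ((memLp_const z).sub (h.memLp n)).integrable_sq

lemma integral_comp_abs_sub_le (h : IsScoreSeq ν q K) {F : ℝ → ℝ}
    (hF : ∀ z w, |F z - F w| ≤ |z - w|) (n : ℕ) (z w : ℝ) :
    |∫ x, F (z - q n x) ∂ν n - ∫ x, F (w - q n x) ∂ν n| ≤ |z - w| := by
  have := h.isProb n
  rw [← integral_sub (h.integrable_comp hF n z) (h.integrable_comp hF n w)]
  refine (abs_integral_le_integral_abs).trans ?_
  calc ∫ x, |F (z - q n x) - F (w - q n x)| ∂ν n ≤ ∫ _, |z - w| ∂ν n := by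
        refine integral_mono
          ((h.integrable_comp hF n z).sub (h.integrable_comp hF n w)).abs (integrable_const _) ?_
        intro x
        simpa using hF (z - q n x) (w - q n x)
    _ = |z - w| := by simp

/-- Averaging over translates, adding a constant and taking minima all preserve the Lipschitz
constant 1. -/
lemma truncVal_abs_sub_le (h : IsScoreSeq ν q K) (k : ℕ) :
    ∀ n z w, |truncVal ν q c k n z - truncVal ν q c k n w| ≤ |z - w| := by
  induction k with
  | zero => exact fun n => g_abs_sub_le
  | succ k ih =>
    intro n z w
    refine (abs_min_sub_min_le_max _ _ _ _).trans (max_le (g_abs_sub_le z w) ?_)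
    rw [add_sub_add_left_eq_sub]
    exact h.integral_comp_abs_sub_le (ih (n + 1)) n z w

lemma truncVal_succ_le (h : IsScoreSeq ν q K) (k : ℕ) :
    ∀ n z, truncVal ν q c (k + 1) n z ≤ truncVal ν q c k n z := by
  induction k with
  | zero => exact fun n z => min_le_left _ _
  | succ k ih =>
    intro n z
    refine min_le_min_left _ (add_le_add_right ?_ c)
    exact integral_mono (h.integrable_comp (h.truncVal_abs_sub_le (k + 1) (n + 1)) n z)
      (h.integrable_comp (h.truncVal_abs_sub_le k (n + 1)) n z) fun x => ih _ _

lemma truncVal_antitone (h : IsScoreSeq ν q K) (n : ℕ) (z : ℝ) :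
    Antitone fun k => truncVal ν q c k n z :=
  antitone_nat_of_succ_le fun k => h.truncVal_succ_le k n z

/-- Since the score is centred, one observation raises the mean of A z² by at most A K ≤ c. The
sampling cost pays for this, so the quadratic bound survives each step of the recursion. -/
lemma neg_quadratic_le_truncVal (h : IsScoreSeq ν q K) {A B : ℝ} (hA : 0 < A) (hAK : A * K ≤ c)
    (hAB : 1 ≤ 4 * A * B) (k : ℕ) : ∀ n z, -(A * z ^ 2 + B) ≤ truncVal ν q c k n z := by
  have hg : ∀ z, -(A * z ^ 2 + B) ≤ g z := by
    intro z
    have hB : 0 < B := by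
      by_contra! hB
      nlinarith
    refine le_min (by nlinarith [mul_nonneg hA.le (sq_nonneg z)]) ?_
    -- The product equals (2 A z + 1)² + (4 A B - 1).
    have : 0 ≤ 4 * A * (A * z ^ 2 + B + z) := by nlinarith [sq_nonneg (2 * A * z + 1)]
    have : 0 ≤ A * z ^ 2 + B + z := nonneg_of_mul_nonneg_right this (by positivity)
    linarith
  induction k with
  | zero => exact fun n => hg
  | succ k ih =>
    intro n z
    refine le_min (hg z) ?_
    have hp := h.isProb n
    have hi : Integrable (fun x => -(A * (z - q n x) ^ 2 + B)) (ν n) :=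
      (((h.integrable_sub_sq n z).const_mul A).add (integrable_const B)).neg
    have h1 : ∫ x, -(A * (z - q n x) ^ 2 + B) ∂ν n
        ≤ ∫ x, truncVal ν q c k (n + 1) (z - q n x) ∂ν n :=
      integral_mono hi (h.integrable_comp (h.truncVal_abs_sub_le k (n + 1)) n z)
        fun x => ih _ _
    rw [integral_neg, integral_add ((h.integrable_sub_sq n z).const_mul A) (integrable_const B),
      integral_const_mul, h.integral_sub_sq n z] at h1
    simp only [integral_const, probReal_univ, smul_eq_mul, one_mul] at h1
    have h2 := mul_le_mul_of_nonneg_left (h.sq_le n) hA.le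
    linarith

/-- The quadratic bound is needed only at z = 0, since the Lipschitz property spreads it linearly.
Uniformity in k and n gives both a finite limit and an integrable dominating function. -/
lemma exists_neg_sub_abs_le_truncVal (h : IsScoreSeq ν q K) (hc : 0 < c) :
    ∃ B, 0 ≤ B ∧ ∀ k n z, -(B + |z|) ≤ truncVal ν q c k n z := by
  have hA : 0 < c / (|K| + 1) := by positivity
  refine ⟨1 / (4 * (c / (|K| + 1))), by positivity, fun k n z => ?_⟩
  have h0 := h.neg_quadratic_le_truncVal (c := c) (A := c / (|K| + 1))
    (B := 1 / (4 * (c / (|K| + 1)))) hA ?_ ?_ k n 0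
  · have h1 := h.truncVal_abs_sub_le (c := c) k n z 0
    rw [sub_zero] at h1
    have := (abs_le.1 h1).1
    simp only [ne_eq, OfNat.ofNat_ne_zero, not_false_eq_true, zero_pow, mul_zero, zero_add] at h0
    linarith
  · rw [div_mul_eq_mul_div, div_le_iff₀ (by positivity)]
    have := le_abs_self K
    nlinarith
  · rw [mul_one_div_cancel (by positivity)]

lemma truncVal_le_g (ν : ℕ → Measure X) (q : ℕ → X → ℝ) (c : ℝ) (k n : ℕ) (z : ℝ) :
    truncVal ν q c k n z ≤ g z := by
  cases k with
  | zero => exact le_rfl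
  | succ k => exact min_le_left _ _

lemma tendsto_truncVal (h : IsScoreSeq ν q K) (hc : 0 < c) (n : ℕ) (z : ℝ) :
    Tendsto (fun k => truncVal ν q c k n z) atTop (𝓝 (val ν q c n z)) := by
  obtain ⟨B, -, hB⟩ := h.exists_neg_sub_abs_le_truncVal hc
  exact tendsto_atTop_ciInf (h.truncVal_antitone n z)
    ⟨-(B + |z|), by rintro _ ⟨k, rfl⟩; exact hB k n z⟩

lemma val_abs_sub_le (h : IsScoreSeq ν q K) (hc : 0 < c) (n : ℕ) (z w : ℝ) :
    |val ν q c n z - val ν q c n w| ≤ |z - w| :=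
  le_of_tendsto ((h.tendsto_truncVal hc n z).sub (h.tendsto_truncVal hc n w)).abs
    (Eventually.of_forall fun k => h.truncVal_abs_sub_le k n z w)

lemma exists_neg_sub_abs_le_val (h : IsScoreSeq ν q K) (hc : 0 < c) :
    ∃ B, 0 ≤ B ∧ ∀ n z, -(B + |z|) ≤ val ν q c n z := by
  obtain ⟨B, hB0, hB⟩ := h.exists_neg_sub_abs_le_truncVal hc
  exact ⟨B, hB0, fun n z => ge_of_tendsto (h.tendsto_truncVal hc n z)
    (Eventually.of_forall fun k => hB k n z)⟩

lemma val_le_g (h : IsScoreSeq ν q K) (hc : 0 < c) (n : ℕ) (z : ℝ) : val ν q c n z ≤ g z :=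
  le_of_tendsto (h.tendsto_truncVal hc n z)
    (Eventually.of_forall fun k => truncVal_le_g ν q c k n z)

lemma tendsto_integral_truncVal (h : IsScoreSeq ν q K) (hc : 0 < c) (n : ℕ) (z : ℝ) :
    Tendsto (fun k => ∫ x, truncVal ν q c k (n + 1) (z - q n x) ∂ν n) atTop
      (𝓝 (contVal ν q c n z)) := by
  have := h.isProb n
  obtain ⟨B, -, hB⟩ := h.exists_neg_sub_abs_le_truncVal hc
  refine tendsto_integral_of_dominated_convergence (fun x => B + |z - q n x|)
    (fun k => (h.integrable_comp (h.truncVal_abs_sub_le k (n + 1)) n z).1)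
    ((integrable_const B).add (h.integrable_sub n z).abs) (fun k => ae_of_all _ fun x => ?_)
    (ae_of_all _ fun x => h.tendsto_truncVal hc _ _)
  have h1 := hB k (n + 1) (z - q n x)
  have h2 := (truncVal_le_g ν q c k (n + 1) (z - q n x)).trans (g_nonpos _)
  rw [Real.norm_eq_abs, abs_of_nonpos h2]
  linarith

/-- The optimality equation is the limit of the truncated recursion; dominated convergence moves the
limit inside the expectation. -/
lemma val_eq_min (h : IsScoreSeq ν q K) (hc : 0 < c) (n : ℕ) (z : ℝ) :
    val ν q c n z = min (g z) (c + contVal ν q c n z) :=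
  tendsto_nhds_unique ((tendsto_add_atTop_iff_nat 1).2 (h.tendsto_truncVal hc n z))
    (tendsto_const_nhds.min (tendsto_const_nhds.add (h.tendsto_integral_truncVal hc n z)))

lemma contVal_abs_sub_le (h : IsScoreSeq ν q K) (hc : 0 < c) (n : ℕ) (z w : ℝ) :
    |contVal ν q c n z - contVal ν q c n w| ≤ |z - w| :=
  h.integral_comp_abs_sub_le (h.val_abs_sub_le hc (n + 1)) n z w

end IsScoreSeq

end ValueFunctions

/-! ### One-step and telescoped identities for a stopping rule. -/

section StoppedProcess

variable {X : Type*} [MeasurableSpace X]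

/-- Law of the first `n` independent observations. -/
noncomputable def pathLaw (ν : ℕ → Measure X) (n : ℕ) : Measure (Fin n → X) :=
  Measure.pi fun i : Fin n => ν i

/-- The statistic `b - (q₁ + ⋯ + qₙ)`. -/
def centred (q : ℕ → X → ℝ) (b : ℝ) (n : ℕ) (x : Fin n → X) : ℝ :=
  b - ∑ i : Fin n, q i (x i)

namespace StoppingRule

lemma t_zero (ψ : StoppingRule X) (x : Fin 0 → X) : ψ.t 0 x = 1 := by simp [t]

lemma t_succ (ψ : StoppingRule X) (n : ℕ) (x : Fin (n + 1) → X) :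
    ψ.t (n + 1) x =
      ψ.t n (fun i => x i.castSucc) * (1 - ψ.prob n fun i => x i.castSucc) := by
  unfold t
  rw [Fin.prod_univ_castSucc]
  rfl

lemma t_nonneg (ψ : StoppingRule X) (n : ℕ) (x : Fin n → X) : 0 ≤ ψ.t n x :=
  Finset.prod_nonneg fun _ _ => sub_nonneg.2 (ψ.le_one _ _)

lemma t_le_one (ψ : StoppingRule X) (n : ℕ) (x : Fin n → X) : ψ.t n x ≤ 1 :=
  Finset.prod_le_one (fun _ _ => sub_nonneg.2 (ψ.le_one _ _))
    fun _ _ => sub_le_self _ (ψ.nonneg _ _)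

lemma measurable_t (ψ : StoppingRule X) (n : ℕ) : Measurable (ψ.t n) := by
  refine Finset.measurable_prod _ fun k _ => measurable_const.sub ((ψ.measurable k).comp ?_)
  exact measurable_pi_lambda _ fun i => measurable_pi_apply _

lemma measurable_s (ψ : StoppingRule X) (n : ℕ) : Measurable (ψ.s n) :=
  (ψ.measurable_t n).mul (ψ.measurable n)

lemma s_nonneg (ψ : StoppingRule X) (n : ℕ) (x : Fin n → X) : 0 ≤ ψ.s n x :=
  mul_nonneg (ψ.t_nonneg n x) (ψ.nonneg n x)

lemma s_le_one (ψ : StoppingRule X) (n : ℕ) (x : Fin n → X) : ψ.s n x ≤ 1 :=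
  mul_le_one₀ (ψ.t_le_one n x) (ψ.nonneg n x) (ψ.le_one n x)

lemma integrable_t_mul {n : ℕ} (ψ : StoppingRule X) {m : Measure (Fin n → X)}
    {F : (Fin n → X) → ℝ} (hF : Integrable F m) : Integrable (fun x => ψ.t n x * F x) m :=
  hF.bdd_mul (c := 1) (ψ.measurable_t n).aestronglyMeasurable
    (ae_of_all _ fun x => by rw [Real.norm_eq_abs, abs_of_nonneg (ψ.t_nonneg n x)]
                             exact ψ.t_le_one n x)

lemma integrable_s_mul {n : ℕ} (ψ : StoppingRule X) {m : Measure (Fin n → X)}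
    {F : (Fin n → X) → ℝ} (hF : Integrable F m) : Integrable (fun x => ψ.s n x * F x) m :=
  hF.bdd_mul (c := 1) (ψ.measurable_s n).aestronglyMeasurable
    (ae_of_all _ fun x => by rw [Real.norm_eq_abs, abs_of_nonneg (ψ.s_nonneg n x)]
                             exact ψ.s_le_one n x)

end StoppingRule

lemma measurePreserving_init_last (ν : ℕ → Measure X) [∀ n, IsProbabilityMeasure (ν n)] (n : ℕ) :
    MeasurePreserving (fun x : Fin (n + 1) → X => ((fun i : Fin n => x i.castSucc), x (Fin.last n)))
      (pathLaw ν (n + 1)) ((pathLaw ν n).prod (ν n)) := by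
  have h1 := measurePreserving_piFinSuccAbove (fun i : Fin (n + 1) => ν i) (Fin.last n)
  simp only [Fin.succAbove_last, Fin.val_last, Fin.val_castSucc] at h1
  have h2 := (Measure.measurePreserving_swap (μ := ν n)
    (ν := Measure.pi fun i : Fin n => ν i)).comp h1
  convert! h2 using 1
  ext x
  · simp [MeasurableEquiv.piFinSuccAbove, Fin.insertNthEquiv, Fin.init]
  · simp [MeasurableEquiv.piFinSuccAbove, Fin.insertNthEquiv]

/-- Probability of taking at least `n` observations. -/
noncomputable def reach (ν : ℕ → Measure X) (ψ : StoppingRule X) (n : ℕ) : ℝ :=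
  ∫ x, ψ.t n x ∂pathLaw ν n

/-- Probability of stopping after exactly `n` observations. -/
noncomputable def halt (ν : ℕ → Measure X) (ψ : StoppingRule X) (n : ℕ) : ℝ :=
  ∫ x, ψ.s n x ∂pathLaw ν n

/-- Contribution of stopping at stage `n` to the expectation of `g (b - z_τ)`. -/
noncomputable def haltGain (ν : ℕ → Measure X) (q : ℕ → X → ℝ) (b : ℝ) (ψ : StoppingRule X)
    (n : ℕ) : ℝ :=
  ∫ x, ψ.s n x * g (centred q b n x) ∂pathLaw ν n

/-- Loss incurred by the randomized decision at stage `n`, relative to the best decision there. -/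
noncomputable def regret (ν : ℕ → Measure X) (q : ℕ → X → ℝ) (b c : ℝ) (ψ : StoppingRule X)
    (n : ℕ) (x : Fin n → X) : ℝ :=
  ψ.prob n x * g (centred q b n x)
    + (1 - ψ.prob n x) * (c + contVal ν q c n (centred q b n x)) - val ν q c n (centred q b n x)

/-- Expected regret at stage `n`. -/
noncomputable def meanRegret (ν : ℕ → Measure X) (q : ℕ → X → ℝ) (b c : ℝ) (ψ : StoppingRule X)
    (n : ℕ) : ℝ :=
  ∫ x, ψ.t n x * regret ν q b c ψ n x ∂pathLaw ν n

/-- Expected remaining value at stage `n`. -/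
noncomputable def meanVal (ν : ℕ → Measure X) (q : ℕ → X → ℝ) (b c : ℝ) (ψ : StoppingRule X)
    (n : ℕ) : ℝ :=
  ∫ x, ψ.t n x * val ν q c n (centred q b n x) ∂pathLaw ν n

variable {ν : ℕ → Measure X} {q : ℕ → X → ℝ} {K b c : ℝ}

omit [MeasurableSpace X] in
lemma centred_zero (q : ℕ → X → ℝ) (b : ℝ) (x : Fin 0 → X) : centred q b 0 x = b := by
  simp [centred]

omit [MeasurableSpace X] in
lemma centred_succ (q : ℕ → X → ℝ) (b : ℝ) (n : ℕ) (x : Fin (n + 1) → X) :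
    centred q b (n + 1) x =
      centred q b n (fun i => x i.castSucc) - q n (x (Fin.last n)) := by
  unfold centred
  rw [Fin.sum_univ_castSucc]
  simp
  ring

namespace IsScoreSeq

lemma isProb_pathLaw (h : IsScoreSeq ν q K) (n : ℕ) : IsProbabilityMeasure (pathLaw ν n) := by
  have := h.isProb
  unfold pathLaw
  infer_instance

lemma measurable_centred (h : IsScoreSeq ν q K) (b : ℝ) (n : ℕ) :
    Measurable (centred q b n) :=
  measurable_const.sub
    (Finset.measurable_sum _ fun i _ => (h.measurable i).comp (measurable_pi_apply i))

lemma memLp_centred (h : IsScoreSeq ν q K) (b : ℝ) (n : ℕ) :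
    MemLp (centred q b n) 2 (pathLaw ν n) := by
  have := h.isProb
  have := h.isProb_pathLaw n
  refine (memLp_const b).sub (memLp_finsetSum _ fun i _ => ?_)
  exact (h.memLp i).comp_measurePreserving (measurePreserving_eval (fun i : Fin n => ν i) i)

lemma integrable_centred (h : IsScoreSeq ν q K) (b : ℝ) (n : ℕ) :
    Integrable (centred q b n) (pathLaw ν n) := by
  have := h.isProb_pathLaw n
  exact (h.memLp_centred b n).integrable (by norm_num)

lemma integrable_centred_sq (h : IsScoreSeq ν q K) (b : ℝ) (n : ℕ) :
    Integrable (fun x => centred q b n x ^ 2) (pathLaw ν n) :=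
  (h.memLp_centred b n).integrable_sq

lemma integrable_comp_centred (h : IsScoreSeq ν q K) {F : ℝ → ℝ}
    (hF : ∀ z w, |F z - F w| ≤ |z - w|) (b : ℝ) (n : ℕ) :
    Integrable (fun x => F (centred q b n x)) (pathLaw ν n) := by
  have := h.isProb_pathLaw n
  exact integrable_comp_of_abs_sub_le hF (h.integrable_centred b n)

/-- The factor `ψ.t (n + 1)` depends only on the first n observations, so Fubini integrates out the
last one. The one-step relations come from F = 1, F = `val` and F = z². -/
lemma integral_t_succ_mul (h : IsScoreSeq ν q K) (ψ : StoppingRule X) (n : ℕ) {F : ℝ → ℝ}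
    (hi : Integrable (fun x => F (centred q b (n + 1) x)) (pathLaw ν (n + 1)))
    (hF : Measurable F) :
    ∫ x, ψ.t (n + 1) x * F (centred q b (n + 1) x) ∂pathLaw ν (n + 1) =
      ∫ x, ψ.t n x * (1 - ψ.prob n x) * (∫ y, F (centred q b n x - q n y) ∂ν n)
        ∂pathLaw ν n := by
  have := h.isProb
  have := h.isProb_pathLaw
  have hmp := measurePreserving_init_last ν n
  let G : (Fin n → X) × X → ℝ := fun z =>
    (ψ.t n z.1 * (1 - ψ.prob n z.1)) * F (centred q b n z.1 - q n z.2)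
  have hGm : Measurable G := by
    have h1 := ψ.measurable_t n
    have h2 := ψ.measurable n
    have h3 := h.measurable_centred b n
    have h4 := h.measurable n
    fun_prop
  have hG : ∀ x : Fin (n + 1) → X, ψ.t (n + 1) x * F (centred q b (n + 1) x)
      = G ((fun i : Fin n => x i.castSucc), x (Fin.last n)) := fun x => by
    simp only [G, ψ.t_succ, centred_succ]
  have hint : Integrable G ((pathLaw ν n).prod (ν n)) := by
    rw [← hmp.integrable_comp hGm.aestronglyMeasurable]
    exact (ψ.integrable_t_mul hi).congr (ae_of_all _ hG)
  simp_rw [hG]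
  rw [← integral_map hmp.measurable.aemeasurable hGm.aestronglyMeasurable, hmp.map_eq,
    integral_prod _ hint]
  exact integral_congr_ae (ae_of_all _ fun x =>
    integral_const_mul (ψ.t n x * (1 - ψ.prob n x)) fun y => F (centred q b n x - q n y))

lemma reach_zero (h : IsScoreSeq ν q K) (ψ : StoppingRule X) : reach ν ψ 0 = 1 := by
  have := h.isProb_pathLaw 0
  simp [reach, ψ.t_zero]

lemma integrable_t (h : IsScoreSeq ν q K) (ψ : StoppingRule X) (n : ℕ) :
    Integrable (ψ.t n) (pathLaw ν n) := by
  have := h.isProb_pathLaw n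
  simpa using ψ.integrable_t_mul (integrable_const (1 : ℝ) (μ := pathLaw ν n))

lemma integrable_s (h : IsScoreSeq ν q K) (ψ : StoppingRule X) (n : ℕ) :
    Integrable (ψ.s n) (pathLaw ν n) := by
  have := h.isProb_pathLaw n
  simpa using ψ.integrable_s_mul (integrable_const (1 : ℝ) (μ := pathLaw ν n))

lemma reach_nonneg (ψ : StoppingRule X) (n : ℕ) : 0 ≤ reach ν ψ n :=
  integral_nonneg fun x => ψ.t_nonneg n x

lemma halt_nonneg (ψ : StoppingRule X) (n : ℕ) : 0 ≤ halt ν ψ n :=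
  integral_nonneg fun x => ψ.s_nonneg n x

lemma reach_succ (h : IsScoreSeq ν q K) (ψ : StoppingRule X) (n : ℕ) :
    reach ν ψ (n + 1) = reach ν ψ n - halt ν ψ n := by
  have := h.isProb
  have := h.isProb_pathLaw
  have h1 := h.integral_t_succ_mul (b := 0) ψ n (F := fun _ => 1) (integrable_const _)
    measurable_const
  simp only [mul_one, integral_const, probReal_univ, smul_eq_mul] at h1
  rw [reach, h1, reach, halt, ← integral_sub (h.integrable_t ψ n) (h.integrable_s ψ n)]
  refine integral_congr_ae (ae_of_all _ fun x => ?_)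
  simp only [StoppingRule.s]
  ring

/-- Of the mass still sampling at stage n, the stopped part collects g, while the rest pays c and
carries the next value function. The excess over the current value is the regret. -/
lemma halt_gain_add (h : IsScoreSeq ν q K) (hc : 0 < c) (b : ℝ) (ψ : StoppingRule X) (n : ℕ) :
    haltGain ν q b ψ n + c * reach ν ψ (n + 1) + meanVal ν q b c ψ (n + 1) =
      meanVal ν q b c ψ n + meanRegret ν q b c ψ n := by
  have := h.isProb
  have := h.isProb_pathLaw
  have hV := h.val_abs_sub_le hc
  have hC := h.contVal_abs_sub_le hc
  have iV := ψ.integrable_t_mul (h.integrable_comp_centred (hV n) b n)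
  have iC := h.integrable_comp_centred (hC n) b n
  have ig := ψ.integrable_s_mul (h.integrable_comp_centred g_abs_sub_le b n)
  have i1 := ψ.integrable_t_mul iC
  have i2 := ψ.integrable_s_mul iC
  have e1 : meanVal ν q b c ψ (n + 1) = ∫ x, ψ.t n x * contVal ν q c n (centred q b n x)
      ∂pathLaw ν n - ∫ x, ψ.s n x * contVal ν q c n (centred q b n x) ∂pathLaw ν n := by
    rw [meanVal, h.integral_t_succ_mul ψ n (h.integrable_comp_centred (hV (n + 1)) b (n + 1))
      (continuous_of_abs_sub_le (hV (n + 1))).measurable, ← integral_sub i1 i2]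
    refine integral_congr_ae (ae_of_all _ fun x => ?_)
    simp only [StoppingRule.s, contVal]
    ring
  have e2 : meanRegret ν q b c ψ n = haltGain ν q b ψ n + c * reach ν ψ (n + 1)
      + meanVal ν q b c ψ (n + 1) - meanVal ν q b c ψ n := by
    have i3 : Integrable (fun x => c * (ψ.t n x - ψ.s n x)) (pathLaw ν n) :=
      ((h.integrable_t ψ n).sub (h.integrable_s ψ n)).const_mul c
    have i4 : Integrable (fun x => ψ.s n x * g (centred q b n x)
        + c * (ψ.t n x - ψ.s n x)) (pathLaw ν n) := ig.add i3
    have i5 : Integrable (fun x => ψ.t n x * contVal ν q c n (centred q b n x)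
        - ψ.s n x * contVal ν q c n (centred q b n x)) (pathLaw ν n) := i1.sub i2
    have i6 : Integrable (fun x => ψ.s n x * g (centred q b n x)
        + c * (ψ.t n x - ψ.s n x) + (ψ.t n x * contVal ν q c n (centred q b n x)
        - ψ.s n x * contVal ν q c n (centred q b n x))) (pathLaw ν n) := i4.add i5
    rw [e1, h.reach_succ, reach, halt, haltGain, meanVal,
      ← integral_sub (h.integrable_t ψ n) (h.integrable_s ψ n), ← integral_const_mul,
      ← integral_sub i1 i2, ← integral_add ig i3, ← integral_add i4 i5, ← integral_sub i6 iV]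
    refine integral_congr_ae (ae_of_all _ fun x => ?_)
    simp only [regret, StoppingRule.s]
    ring
  linarith

/-- Second moment of the stopped statistic accumulates at rate at most `K`. -/
lemma second_moment_succ_le (h : IsScoreSeq ν q K) (b : ℝ) (ψ : StoppingRule X) (n : ℕ) :
    ∫ x, ψ.s n x * centred q b n x ^ 2 ∂pathLaw ν n
        + ∫ x, ψ.t (n + 1) x * centred q b (n + 1) x ^ 2 ∂pathLaw ν (n + 1) ≤
      ∫ x, ψ.t n x * centred q b n x ^ 2 ∂pathLaw ν n + K * reach ν ψ (n + 1) := by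
  have := h.isProb
  have := h.isProb_pathLaw
  have h1 := h.integral_t_succ_mul ψ n (F := fun z => z ^ 2) (h.integrable_centred_sq b (n + 1))
    (by fun_prop)
  have it := ψ.integrable_t_mul (h.integrable_centred_sq b n)
  have is := ψ.integrable_s_mul (h.integrable_centred_sq b n)
  have id : Integrable (fun x => (∫ y, q n y ^ 2 ∂ν n) * (ψ.t n x - ψ.s n x)) (pathLaw ν n) :=
    ((h.integrable_t ψ n).sub (h.integrable_s ψ n)).const_mul _
  have its : Integrable (fun x => ψ.t n x * centred q b n x ^ 2
      - ψ.s n x * centred q b n x ^ 2) (pathLaw ν n) := it.sub is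
  simp_rw [h.integral_sub_sq n] at h1
  have e1 : ∫ x, ψ.t n x * (1 - ψ.prob n x) * (centred q b n x ^ 2 + ∫ y, q n y ^ 2 ∂ν n)
      ∂pathLaw ν n = ∫ x, ψ.t n x * centred q b n x ^ 2 ∂pathLaw ν n
        - ∫ x, ψ.s n x * centred q b n x ^ 2 ∂pathLaw ν n
        + (∫ y, q n y ^ 2 ∂ν n) * reach ν ψ (n + 1) := by
    rw [h.reach_succ, reach, halt, ← integral_sub (h.integrable_t ψ n) (h.integrable_s ψ n),
      ← integral_const_mul, ← integral_sub it is, ← integral_add its id]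
    refine integral_congr_ae (ae_of_all _ fun x => ?_)
    simp only [StoppingRule.s]
    ring
  rw [h1, e1]
  have := mul_le_mul_of_nonneg_right (h.sq_le n) (reach_nonneg (ν := ν) ψ (n + 1))
  linarith

/-- Telescoped balance, valid without any assumption on the sample size. It is used both to evaluate
the cost of a rule and to prove that the optimal rule has finite mean sample size. -/
lemma sum_halt_gain_add (h : IsScoreSeq ν q K) (hc : 0 < c) (b : ℝ) (ψ : StoppingRule X)
    (N : ℕ) :
    ∑ n ∈ Finset.range N, haltGain ν q b ψ n + c * ∑ n ∈ Finset.range N, reach ν ψ (n + 1)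
        + meanVal ν q b c ψ N =
      val ν q c 0 b + ∑ n ∈ Finset.range N, meanRegret ν q b c ψ n := by
  induction N with
  | zero =>
    have := h.isProb_pathLaw 0
    simp [meanVal, ψ.t_zero, centred_zero]
  | succ N ih =>
    simp only [Finset.sum_range_succ, mul_add]
    linarith [h.halt_gain_add hc b ψ N]

/-- A Wald-type inequality: the second moment at min(τ, N) is at most b² + K E min(τ, N), the sum of
reach probabilities being that expectation. -/
lemma sum_second_moment_le (h : IsScoreSeq ν q K) (b : ℝ) (ψ : StoppingRule X) (N : ℕ) :
    ∑ n ∈ Finset.range N, ∫ x, ψ.s n x * centred q b n x ^ 2 ∂pathLaw ν n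
        + ∫ x, ψ.t N x * centred q b N x ^ 2 ∂pathLaw ν N ≤
      b ^ 2 + K * ∑ n ∈ Finset.range N, reach ν ψ (n + 1) := by
  induction N with
  | zero =>
    have := h.isProb_pathLaw 0
    simp [ψ.t_zero, centred_zero]
  | succ N ih =>
    simp only [Finset.sum_range_succ, mul_add]
    linarith [h.second_moment_succ_le b ψ N]

lemma sum_halt_add_reach (h : IsScoreSeq ν q K) (ψ : StoppingRule X) (N : ℕ) :
    ∑ n ∈ Finset.range N, halt ν ψ n + reach ν ψ N = 1 := by
  induction N with
  | zero => simp [h.reach_zero ψ]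
  | succ N ih => rw [Finset.sum_range_succ, h.reach_succ]; linarith

lemma regret_nonneg (h : IsScoreSeq ν q K) (hc : 0 < c) (b : ℝ) (ψ : StoppingRule X) (n : ℕ)
    (x : Fin n → X) : 0 ≤ regret ν q b c ψ n x := by
  have h1 := h.val_eq_min hc n (centred q b n x)
  have h2 : val ν q c n (centred q b n x) ≤ g (centred q b n x) := h1 ▸ min_le_left _ _
  have h3 : val ν q c n (centred q b n x) ≤ c + contVal ν q c n (centred q b n x) :=
    h1 ▸ min_le_right _ _
  have h4 := mul_le_mul_of_nonneg_left h2 (ψ.nonneg n x)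
  have h5 := mul_le_mul_of_nonneg_left h3 (sub_nonneg.2 (ψ.le_one n x))
  unfold regret
  linarith

lemma meanRegret_nonneg (h : IsScoreSeq ν q K) (hc : 0 < c) (b : ℝ) (ψ : StoppingRule X)
    (n : ℕ) : 0 ≤ meanRegret ν q b c ψ n :=
  integral_nonneg fun x => mul_nonneg (ψ.t_nonneg n x) (h.regret_nonneg hc b ψ n x)

/-- With G the cost of stopping and C that of continuing, the regret is (1 - ψ)(C - G) or ψ(G - C),
according to which is smaller. At a tie every randomization is free of regret. -/
lemma regret_eq_zero_iff (h : IsScoreSeq ν q K) (hc : 0 < c) (b : ℝ) (ψ : StoppingRule X)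
    (n : ℕ) (x : Fin n → X) :
    regret ν q b c ψ n x = 0 ↔
      (g (centred q b n x) < c + contVal ν q c n (centred q b n x) → ψ.prob n x = 1) ∧
      (c + contVal ν q c n (centred q b n x) < g (centred q b n x) → ψ.prob n x = 0) := by
  rw [regret, h.val_eq_min hc]
  set G := g (centred q b n x)
  set C := c + contVal ν q c n (centred q b n x)
  rcases lt_trichotomy G C with hl | he | hl
  · rw [min_eq_left hl.le]
    have : ψ.prob n x * G + (1 - ψ.prob n x) * C - G = (1 - ψ.prob n x) * (C - G) := by ring
    rw [this, mul_eq_zero, or_iff_left (sub_pos.2 hl).ne', sub_eq_zero]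
    simp [hl, hl.le, eq_comm]
  · rw [he, min_self]
    simp only [lt_irrefl, false_imp_iff, and_self, iff_true]
    ring
  · rw [min_eq_right hl.le]
    have : ψ.prob n x * G + (1 - ψ.prob n x) * C - C = ψ.prob n x * (G - C) := by ring
    rw [this, mul_eq_zero, or_iff_left (sub_pos.2 hl).ne']
    simp [hl, hl.le]

lemma integrable_regret (h : IsScoreSeq ν q K) (hc : 0 < c) (b : ℝ) (ψ : StoppingRule X)
    (n : ℕ) : Integrable (fun x => ψ.t n x * regret ν q b c ψ n x) (pathLaw ν n) := by
  have := h.isProb_pathLaw n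
  have iV := ψ.integrable_t_mul (h.integrable_comp_centred (h.val_abs_sub_le hc n) b n)
  have iC := (integrable_const c).add
    (h.integrable_comp_centred (h.contVal_abs_sub_le hc n) b n)
  have ig := ψ.integrable_s_mul (h.integrable_comp_centred g_abs_sub_le b n)
  refine (((ig.add (ψ.integrable_t_mul iC)).sub (ψ.integrable_s_mul iC)).sub iV).congr
    (ae_of_all _ fun x => ?_)
  simp only [regret, StoppingRule.s, Pi.add_apply, Pi.sub_apply]
  ring

lemma meanRegret_eq_zero_iff (h : IsScoreSeq ν q K) (hc : 0 < c) (b : ℝ) (ψ : StoppingRule X)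
    (n : ℕ) :
    meanRegret ν q b c ψ n = 0 ↔ ∀ᵐ x ∂pathLaw ν n, 0 < ψ.t n x → regret ν q b c ψ n x = 0 := by
  rw [meanRegret, integral_eq_zero_iff_of_nonneg
    (fun x => mul_nonneg (ψ.t_nonneg n x) (h.regret_nonneg hc b ψ n x))
    (h.integrable_regret hc b ψ n)]
  refine eventually_congr (ae_of_all _ fun x => ?_)
  have := ψ.t_nonneg n x
  simp only [Pi.zero_apply, mul_eq_zero]
  constructor
  · rintro (h0 | h0) hx
    · exact absurd h0 hx.ne'
    · exact h0
  · intro h0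
    rcases this.eq_or_lt with h1 | h1
    · exact Or.inl h1.symm
    · exact Or.inr (h0 h1)

end IsScoreSeq

end StoppedProcess

/-! ### Means of integer-valued variables through their tails. -/

section TailSums

variable {e p : ℕ → ℝ}

lemma sum_mul_add_tail (hs : ∀ n, e (n + 1) = e n - p n) (N : ℕ) :
    ∑ n ∈ Finset.range N, n * p n + N * e N = ∑ n ∈ Finset.range N, e (n + 1) := by
  induction N with
  | zero => simp
  | succ N ih =>
    rw [Finset.sum_range_succ, Finset.sum_range_succ, ← ih, hs N]
    push_cast
    ring

lemma hasSum_of_tail_tendsto_zero (hp : ∀ n, 0 ≤ p n) (hs : ∀ n, e (n + 1) = e n - p n)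
    (he : Tendsto e atTop (𝓝 0)) (N : ℕ) : HasSum (fun m => p (m + N)) (e N) := by
  rw [hasSum_iff_tendsto_nat_of_nonneg fun m => hp _]
  have h1 : ∀ M, ∑ m ∈ Finset.range M, p (m + N) = e N - e (M + N) := by
    intro M
    induction M with
    | zero => simp
    | succ M ih =>
      rw [Finset.sum_range_succ, ih, Nat.add_right_comm, hs]
      ring
  simp_rw [h1]
  simpa using tendsto_const_nhds.sub ((tendsto_add_atTop_iff_nat N).2 he)

/-- N e_N is the sum of N p_m over m ≥ N, hence at most the tail of the convergent series of m p_m.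
-/
lemma tendsto_mul_tail (he0 : ∀ n, 0 ≤ e n) (hp : ∀ n, 0 ≤ p n)
    (hs : ∀ n, e (n + 1) = e n - p n) (he : Tendsto e atTop (𝓝 0))
    (hsum : Summable fun n : ℕ => n * p n) : Tendsto (fun N : ℕ => N * e N) atTop (𝓝 0) := by
  refine squeeze_zero (fun N => mul_nonneg N.cast_nonneg (he0 N)) (fun N => ?_)
    (tendsto_sum_nat_add fun n : ℕ => n * p n)
  have h1 := hasSum_of_tail_tendsto_zero hp hs he N
  rw [← h1.tsum_eq, ← tsum_mul_left]
  refine (h1.summable.mul_left _).tsum_le_tsum (fun m => ?_) ((summable_nat_add_iff N).2 hsum)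
  refine mul_le_mul_of_nonneg_right ?_ (hp _)
  push_cast
  linarith [(Nat.cast_nonneg m : (0 : ℝ) ≤ m)]

/-- Abel summation first bounds the partial sums of n p_n; with summability known, the boundary term
N e_N vanishes and the two sums agree. -/
lemma hasSum_mul_of_summable_tail (he0 : ∀ n, 0 ≤ e n) (hp : ∀ n, 0 ≤ p n)
    (hs : ∀ n, e (n + 1) = e n - p n) (h : Summable e) :
    HasSum (fun n : ℕ => n * p n) (∑' n, e (n + 1)) := by
  have he := h.tendsto_atTop_zero
  have h1 : Summable fun n => e (n + 1) := (summable_nat_add_iff 1).2 h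
  have hn : ∀ n : ℕ, 0 ≤ n * p n := fun n => mul_nonneg n.cast_nonneg (hp n)
  have hsum : Summable fun n : ℕ => n * p n := by
    refine summable_of_sum_range_le hn (c := ∑' n, e (n + 1)) fun N => ?_
    have h2 := sum_mul_add_tail hs N
    have h3 := h1.sum_le_tsum (Finset.range N) fun n _ => he0 (n + 1)
    have := mul_nonneg (N.cast_nonneg : (0 : ℝ) ≤ N) (he0 N)
    linarith
  rw [hasSum_iff_tendsto_nat_of_nonneg hn]
  have h4 := h1.hasSum.tendsto_sum_nat.sub (tendsto_mul_tail he0 hp hs he hsum)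
  rw [sub_zero] at h4
  refine h4.congr fun N => ?_
  rw [← sum_mul_add_tail hs N]
  ring

/-- The mean of an almost surely finite `ℕ`-valued variable, with point masses `p` and tail
probabilities `e`, is finite iff its tail probabilities are summable. -/
lemma mean_lt_top_iff_summable_tail (he0 : ∀ n, 0 ≤ e n) (hp : ∀ n, 0 ≤ p n)
    (hs : ∀ n, e (n + 1) = e n - p n) (h0 : e 0 = 1) :
    (if ∑' n, ENNReal.ofReal (p n) = 1 then ∑' n : ℕ, (n : ℝ≥0∞) * ENNReal.ofReal (p n)
      else ∞) < ∞ ↔ Summable e := by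
  have hmul : ∀ n : ℕ, (n : ℝ≥0∞) * ENNReal.ofReal (p n) = ENNReal.ofReal (n * p n) := fun n => by
    rw [ENNReal.ofReal_mul n.cast_nonneg, ENNReal.ofReal_natCast]
  have hn : ∀ n : ℕ, 0 ≤ n * p n := fun n => mul_nonneg n.cast_nonneg (hp n)
  simp_rw [hmul]
  constructor
  · intro h
    split_ifs at h with h1
    · have hsp : Summable p := by
        have := ENNReal.summable_toReal (h1.trans_ne ENNReal.one_ne_top)
        simpa [ENNReal.toReal_ofReal (hp _)] using this
      have hsn : Summable fun n : ℕ => n * p n := by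
        have := ENNReal.summable_toReal h.ne
        simpa only [ENNReal.toReal_ofReal (hn _)] using this
      have ht : ∑' n, p n = 1 := by
        rw [← ENNReal.ofReal_tsum_of_nonneg hp hsp] at h1
        simpa using h1
      have he : Tendsto e atTop (𝓝 0) := by
        have h2 := hsp.hasSum.tendsto_sum_nat
        rw [ht] at h2
        have h3 : ∀ N, 1 - ∑ n ∈ Finset.range N, p n = e N := by
          intro N
          induction N with
          | zero => simp [h0]
          | succ N ih => rw [Finset.sum_range_succ, hs, ← ih]; ring
        simpa [h3] using (tendsto_const_nhds (x := (1 : ℝ))).sub h2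
      have h5 : Tendsto (fun N => ∑ n ∈ Finset.range N, e (n + 1)) atTop
          (𝓝 (∑' n : ℕ, n * p n + 0)) :=
        (hsn.hasSum.tendsto_sum_nat.add (tendsto_mul_tail he0 hp hs he hsn)).congr
          fun N => sum_mul_add_tail hs N
      exact (summable_nat_add_iff 1).1
        ((hasSum_iff_tendsto_nat_of_nonneg (fun n => he0 (n + 1)) _).2 h5).summable
    · exact absurd h (lt_irrefl _)
  · intro h
    have h1 := hasSum_of_tail_tendsto_zero hp hs h.tendsto_atTop_zero 0
    simp only [add_zero, h0] at h1
    rw [if_pos, ← ENNReal.ofReal_tsum_of_nonneg hn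
      (hasSum_mul_of_summable_tail he0 hp hs h).summable]
    · exact ENNReal.ofReal_lt_top
    · rw [← ENNReal.ofReal_tsum_of_nonneg hp h1.summable, h1.tsum_eq, ENNReal.ofReal_one]

end TailSums

/-! ### Cost as total regret, and the optimality criterion. -/

section OptimalStopping

variable {X : Type*} [MeasurableSpace X] {ν : ℕ → Measure X} {q : ℕ → X → ℝ} {K b c : ℝ}

/-- Expected cost `E (c τ + g (b - z_τ))` of a stopping rule. -/
noncomputable def payoff (ν : ℕ → Measure X) (q : ℕ → X → ℝ) (b c : ℝ) (ψ : StoppingRule X) : ℝ :=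
  ∑' n : ℕ, ∫ x, ψ.s n x * (n * c + g (centred q b n x)) ∂pathLaw ν n

namespace IsScoreSeq

lemma nonneg (h : IsScoreSeq ν q K) : 0 ≤ K :=
  (integral_nonneg fun _ => sq_nonneg _).trans (h.sq_le 0)

lemma haltGain_nonpos (ψ : StoppingRule X) (n : ℕ) : haltGain ν q b ψ n ≤ 0 :=
  integral_nonpos fun x => mul_nonpos_of_nonneg_of_nonpos (ψ.s_nonneg n x) (g_nonpos _)

lemma meanVal_nonpos (h : IsScoreSeq ν q K) (hc : 0 < c) (b : ℝ) (ψ : StoppingRule X) (n : ℕ) :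
    meanVal ν q b c ψ n ≤ 0 :=
  integral_nonpos fun x => mul_nonpos_of_nonneg_of_nonpos (ψ.t_nonneg n x)
    ((h.val_le_g hc n _).trans (g_nonpos _))

/-- Completing the square. The free ε lets second moments be absorbed at an arbitrarily small price.
-/
lemma abs_le_sq_add {ε : ℝ} (hε : 0 < ε) (z : ℝ) : |z| ≤ ε * z ^ 2 + 1 / (4 * ε) := by
  have h1 : ε * z ^ 2 + 1 / (4 * ε) - |z| = (2 * ε * |z| - 1) ^ 2 / (4 * ε) := by
    field_simp
    rw [← sq_abs z]
    ring
  have h2 : 0 ≤ (2 * ε * |z| - 1) ^ 2 / (4 * ε) := by positivity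
  linarith

lemma neg_le_haltGain (h : IsScoreSeq ν q K) (b : ℝ) (ψ : StoppingRule X) {ε : ℝ} (hε : 0 < ε)
    (n : ℕ) :
    -(ε * ∫ x, ψ.s n x * centred q b n x ^ 2 ∂pathLaw ν n + 1 / (4 * ε) * halt ν ψ n) ≤
      haltGain ν q b ψ n := by
  have i1 := (ψ.integrable_s_mul (h.integrable_centred_sq b n)).const_mul ε
  have i2 := (h.integrable_s ψ n).const_mul (1 / (4 * ε))
  have i3 := ψ.integrable_s_mul (h.integrable_comp_centred g_abs_sub_le b n)
  rw [halt, ← integral_const_mul, ← integral_const_mul, ← integral_add i1 i2, ← integral_neg]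
  refine integral_mono (i1.add i2).neg i3 fun x => ?_
  have h1 : -(ε * centred q b n x ^ 2 + 1 / (4 * ε)) ≤ g (centred q b n x) := by
    have := abs_le_sq_add hε (centred q b n x)
    refine le_min ?_ ?_
    · linarith [abs_nonneg (centred q b n x)]
    · linarith [neg_abs_le (centred q b n x)]
  have := mul_le_mul_of_nonneg_left h1 (ψ.s_nonneg n x)
  simp only
  linarith

lemma exists_neg_le_meanVal (h : IsScoreSeq ν q K) (hc : 0 < c) (b : ℝ) (ψ : StoppingRule X) :
    ∃ B, 0 ≤ B ∧ ∀ ε : ℝ, 0 < ε → ∀ n,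
    -(ε * ∫ x, ψ.t n x * centred q b n x ^ 2 ∂pathLaw ν n + (B + 1 / (4 * ε)) * reach ν ψ n) ≤
      meanVal ν q b c ψ n := by
  obtain ⟨B, hB0, hB⟩ := h.exists_neg_sub_abs_le_val hc
  refine ⟨B, hB0, fun ε hε n => ?_⟩
  have i1 := (ψ.integrable_t_mul (h.integrable_centred_sq b n)).const_mul ε
  have i2 := (h.integrable_t ψ n).const_mul (B + 1 / (4 * ε))
  have i3 := ψ.integrable_t_mul (h.integrable_comp_centred (h.val_abs_sub_le hc n) b n)
  rw [reach, ← integral_const_mul, ← integral_const_mul, ← integral_add i1 i2, ← integral_neg]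
  refine integral_mono (i1.add i2).neg i3 fun x => ?_
  have h1 : -(ε * centred q b n x ^ 2 + (B + 1 / (4 * ε))) ≤ val ν q c n (centred q b n x) := by
    linarith [abs_le_sq_add hε (centred q b n x), hB n (centred q b n x)]
  have := mul_le_mul_of_nonneg_left h1 (ψ.t_nonneg n x)
  simp only
  linarith

lemma second_moment_nonneg (q : ℕ → X → ℝ) (b : ℝ) (ψ : StoppingRule X) (n : ℕ) :
    0 ≤ ∫ x, ψ.s n x * centred q b n x ^ 2 ∂pathLaw ν n :=
  integral_nonneg fun x => mul_nonneg (ψ.s_nonneg n x) (sq_nonneg _)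

/-- The second moment on the unstopped part is bounded by some Y, so its ε-multiple is small
uniformly in the stage; the remaining term is a multiple of the reach probability, which tends to
zero. -/
lemma tendsto_meanVal (h : IsScoreSeq ν q K) (hc : 0 < c) (b : ℝ) (ψ : StoppingRule X)
    (hψ : Summable (reach ν ψ)) : Tendsto (meanVal ν q b c ψ) atTop (𝓝 0) := by
  obtain ⟨B, hB0, hB⟩ := h.exists_neg_le_meanVal hc b ψ
  have h1 : Summable fun n => reach ν ψ (n + 1) := (summable_nat_add_iff 1).2 hψ
  set Y := b ^ 2 + K * ∑' n, reach ν ψ (n + 1) with hY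
  have hK := h.nonneg
  have hY0 : 0 ≤ Y := add_nonneg (sq_nonneg b)
    (mul_nonneg hK (tsum_nonneg fun n => reach_nonneg ψ (n + 1)))
  have hy : ∀ N, ∫ x, ψ.t N x * centred q b N x ^ 2 ∂pathLaw ν N ≤ Y := by
    intro N
    have h2 := h.sum_second_moment_le b ψ N
    have h3 : 0 ≤ ∑ n ∈ Finset.range N, ∫ x, ψ.s n x * centred q b n x ^ 2 ∂pathLaw ν n :=
      Finset.sum_nonneg fun n _ => second_moment_nonneg q b ψ n
    have h4 := mul_le_mul_of_nonneg_left
      (h1.sum_le_tsum (Finset.range N) fun n _ => reach_nonneg ψ (n + 1)) hK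
    linarith
  rw [Metric.tendsto_atTop]
  intro η hη
  -- This gives ε Y ≤ η / 2; the added 1 covers Y = 0.
  have hε : 0 < η / (2 * (Y + 1)) := by positivity
  set ε := η / (2 * (Y + 1)) with hεd
  have h5 : Tendsto (fun n => (B + 1 / (4 * ε)) * reach ν ψ n) atTop (𝓝 0) := by
    simpa using hψ.tendsto_atTop_zero.const_mul (B + 1 / (4 * ε))
  obtain ⟨N, hN⟩ := (h5.eventually (gt_mem_nhds (half_pos hη))).exists_forall_of_atTop
  refine ⟨N, fun n hn => ?_⟩
  rw [Real.dist_eq, sub_zero, abs_of_nonpos (h.meanVal_nonpos hc b ψ n)]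
  have h6 := hB ε hε n
  have h7 := hN n hn
  have h8 := mul_le_mul_of_nonneg_left (hy n) hε.le
  have h9 : ε * Y ≤ η / 2 := by
    rw [hεd, div_mul_eq_mul_div, div_le_div_iff₀ (by positivity) (by positivity)]
    nlinarith
  linarith

/-- Limit of `sum_halt_gain_add`. Gains are nonpositive and regrets nonnegative, so bounded partial
sums give convergence of both series, and the reach probabilities from stage 1 on sum to the mean
sample size. -/
lemma payoff_eq (h : IsScoreSeq ν q K) (hc : 0 < c) (b : ℝ) (ψ : StoppingRule X)
    (hψ : Summable (reach ν ψ)) :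
    Summable (meanRegret ν q b c ψ) ∧
      payoff ν q b c ψ = val ν q c 0 b + ∑' n, meanRegret ν q b c ψ n := by
  have h1 : Summable fun n => reach ν ψ (n + 1) := (summable_nat_add_iff 1).2 hψ
  have hle := fun N => mul_le_mul_of_nonneg_left
    (h1.sum_le_tsum (Finset.range N) fun n _ => reach_nonneg ψ (n + 1)) hc.le
  have hreg0 := h.meanRegret_nonneg hc b ψ
  have hreg : Summable (meanRegret ν q b c ψ) := by
    refine summable_of_sum_range_le hreg0
      (c := c * ∑' n, reach ν ψ (n + 1) - val ν q c 0 b) fun N => ?_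
    have h2 := h.sum_halt_gain_add hc b ψ N
    have h3 : ∑ n ∈ Finset.range N, haltGain ν q b ψ n ≤ 0 :=
      Finset.sum_nonpos fun n _ => haltGain_nonpos ψ n
    have h4 := h.meanVal_nonpos hc b ψ N
    linarith [hle N]
  refine ⟨hreg, ?_⟩
  have hgain : Summable (haltGain ν q b ψ) := by
    rw [← summable_neg_iff]
    refine summable_of_sum_range_le (fun n => neg_nonneg.2 (haltGain_nonpos ψ n))
      (c := c * ∑' n, reach ν ψ (n + 1) - val ν q c 0 b) fun N => ?_
    have h2 := h.sum_halt_gain_add hc b ψ N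
    have h3 : 0 ≤ ∑ n ∈ Finset.range N, meanRegret ν q b c ψ n :=
      Finset.sum_nonneg fun n _ => hreg0 n
    have h4 := h.meanVal_nonpos hc b ψ N
    simp only [Finset.sum_neg_distrib]
    linarith [hle N]
  have hlim : ∑' n, haltGain ν q b ψ n + c * ∑' n, reach ν ψ (n + 1) + 0 =
      val ν q c 0 b + ∑' n, meanRegret ν q b c ψ n :=
    tendsto_nhds_unique ((hgain.hasSum.tendsto_sum_nat.add
      (h1.hasSum.tendsto_sum_nat.const_mul c)).add (h.tendsto_meanVal hc b ψ hψ))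
      ((tendsto_const_nhds.add hreg.hasSum.tendsto_sum_nat).congr
        fun N => (h.sum_halt_gain_add hc b ψ N).symm)
  have hmean := hasSum_mul_of_summable_tail (reach_nonneg (ν := ν) ψ) (halt_nonneg ψ)
    (h.reach_succ ψ) hψ
  have hterm : ∀ n : ℕ, ∫ x, ψ.s n x * (n * c + g (centred q b n x)) ∂pathLaw ν n =
      haltGain ν q b ψ n + c * (n * halt ν ψ n) := by
    intro n
    rw [haltGain, halt, ← mul_assoc, ← integral_const_mul,
      ← integral_add (ψ.integrable_s_mul (h.integrable_comp_centred g_abs_sub_le b n))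
        ((h.integrable_s ψ n).const_mul _)]
    refine integral_congr_ae (ae_of_all _ fun x => ?_)
    simp only
    ring
  rw [payoff, tsum_congr hterm, (hgain.hasSum.add (hmean.mul_left c)).tsum_eq, ← hlim, add_zero]

/-- The rule that stops as soon as stopping is at least as good as continuing. -/
noncomputable def optimalRule (h : IsScoreSeq ν q K) (hc : 0 < c) (b : ℝ) : StoppingRule X where
  prob n := {x | n ≠ 0 ∧ g (centred q b n x) ≤
    c + contVal ν q c n (centred q b n x)}.indicator 1
  measurable n := by
    have hm : MeasurableSet {x | g (centred q b n x) ≤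
        c + contVal ν q c n (centred q b n x)} := measurableSet_le
      ((continuous_of_abs_sub_le g_abs_sub_le).measurable.comp (h.measurable_centred b n))
      (measurable_const.add ((continuous_of_abs_sub_le
        (h.contVal_abs_sub_le hc n)).measurable.comp (h.measurable_centred b n)))
    exact measurable_one.indicator ((MeasurableSet.const _).inter hm)
  nonneg n x := Set.indicator_nonneg (fun _ _ => zero_le_one) x
  le_one n x := Set.indicator_le_self' (fun _ _ => zero_le_one) x
  prob_zero x := Set.indicator_of_notMem (by simp) _

lemma regret_optimalRule (h : IsScoreSeq ν q K) (hc : 0 < c) (b : ℝ) {n : ℕ} (hn : n ≠ 0)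
    (x : Fin n → X) : regret ν q b c (h.optimalRule hc b) n x = 0 := by
  rw [h.regret_eq_zero_iff hc]
  constructor
  · intro hlt
    exact Set.indicator_of_mem (show x ∈ {x | _ ∧ _} from ⟨hn, hlt.le⟩) _
  · intro hlt
    exact Set.indicator_of_notMem (fun hx => hlt.not_ge hx.2) _

lemma meanRegret_optimalRule (h : IsScoreSeq ν q K) (hc : 0 < c) (b : ℝ) {n : ℕ} (hn : n ≠ 0) :
    meanRegret ν q b c (h.optimalRule hc b) n = 0 :=
  (h.meanRegret_eq_zero_iff hc b _ n).2
    (ae_of_all _ fun x _ => h.regret_optimalRule hc b hn x)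

/-- The right-hand side does not involve the rule, so the cost of the compulsory first observation
cancels in every comparison. -/
lemma meanRegret_zero (h : IsScoreSeq ν q K) (b c : ℝ) (ψ : StoppingRule X) :
    meanRegret ν q b c ψ 0 = c + contVal ν q c 0 b - val ν q c 0 b := by
  have := h.isProb_pathLaw 0
  simp [meanRegret, regret, ψ.t_zero, ψ.prob_zero, centred_zero]

/-- The telescoped balance bounds c E min(τ, N) by a constant plus the mean absolute statistic at
min(τ, N). By the Wald-type inequality the latter costs at most half of the left side, plus a
constant, and is absorbed. -/
lemma summable_reach_optimalRule (h : IsScoreSeq ν q K) (hc : 0 < c) (b : ℝ) :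
    Summable (reach ν (h.optimalRule hc b)) := by
  set ψ := h.optimalRule hc b
  obtain ⟨B, hB0, hB⟩ := h.exists_neg_le_meanVal hc b ψ
  have hK := h.nonneg
  -- Chosen so that ε K ≤ c / 2, leaving half the sampling cost after absorption.
  set ε := c / (2 * (K + 1)) with hεd
  have hε : 0 < ε := by positivity
  have hεK : ε * K ≤ c / 2 := by
    rw [hεd, div_mul_eq_mul_div, div_le_div_iff₀ (by positivity) (by positivity)]
    nlinarith
  refine (summable_nat_add_iff 1).1 (summable_of_sum_range_le
    (fun n => reach_nonneg ψ (n + 1))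
    (c := 2 / c * (val ν q c 0 b + meanRegret ν q b c ψ 0 + ε * b ^ 2 + B + 1 / (4 * ε)))
    fun N => ?_)
  have h1 := h.sum_halt_gain_add hc b ψ N
  have h2 := h.sum_second_moment_le b ψ N
  have h3 := h.sum_halt_add_reach ψ N
  have h4 := hB ε hε N
  have h5 : ∑ n ∈ Finset.range N, meanRegret ν q b c ψ n ≤ meanRegret ν q b c ψ 0 := by
    have h0 := h.meanRegret_nonneg hc b ψ 0
    cases N with
    | zero => simpa using h0
    | succ N =>
      rw [Finset.sum_range_succ', Finset.sum_eq_zero fun n _ =>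
        h.meanRegret_optimalRule hc b n.succ_ne_zero, zero_add]
  have h6 := Finset.sum_le_sum fun n (_ : n ∈ Finset.range N) => h.neg_le_haltGain b ψ hε n
  rw [Finset.sum_neg_distrib, Finset.sum_add_distrib, ← Finset.mul_sum, ← Finset.mul_sum] at h6
  set R := ∑ n ∈ Finset.range N, reach ν ψ (n + 1)
  have hR : 0 ≤ R := Finset.sum_nonneg fun n _ => reach_nonneg ψ (n + 1)
  have h7 := mul_le_mul_of_nonneg_left h2 hε.le
  have h8 := mul_le_mul_of_nonneg_right hεK hR
  have h9 : reach ν ψ N ≤ 1 := by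
    have : 0 ≤ ∑ n ∈ Finset.range N, halt ν ψ n := Finset.sum_nonneg fun n _ => halt_nonneg ψ n
    linarith
  have h10 := mul_le_mul_of_nonneg_left h9 hB0
  have h11 : 1 / (4 * ε) * ∑ n ∈ Finset.range N, halt ν ψ n + 1 / (4 * ε) * reach ν ψ N =
      1 / (4 * ε) := by rw [← mul_add, h3, mul_one]
  have h12 : c / 2 * R ≤
      val ν q c 0 b + meanRegret ν q b c ψ 0 + ε * b ^ 2 + B + 1 / (4 * ε) := by
    linarith
  calc R = 2 / c * (c / 2 * R) := by field_simp
    _ ≤ _ := mul_le_mul_of_nonneg_left h12 (by positivity)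

/-- A rule with finite mean sample size is optimal iff its decisions carry no regret. -/
theorem isGLB_payoff_iff (h : IsScoreSeq ν q K) (hc : 0 < c) (b : ℝ) (ψ : StoppingRule X)
    (hψ : Summable (reach ν ψ)) :
    IsGLB (payoff ν q b c '' {φ | Summable (reach ν φ)}) (payoff ν q b c ψ) ↔
      ∀ n, 1 ≤ n → meanRegret ν q b c ψ n = 0 := by
  obtain ⟨hs, he⟩ := h.payoff_eq hc b ψ hψ
  have hr := h.meanRegret_nonneg hc b ψ
  constructor
  · intro hglb n hn
    -- Compared with `optimalRule`, whose only regret is the common one at stage 0.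
    have h1 := hglb.1 ⟨_, h.summable_reach_optimalRule hc b, rfl⟩
    obtain ⟨-, he'⟩ := h.payoff_eq hc b _ (h.summable_reach_optimalRule hc b)
    rw [he, he', tsum_eq_single 0 fun n hn => h.meanRegret_optimalRule hc b hn,
      h.meanRegret_zero, ← h.meanRegret_zero b c ψ] at h1
    -- The total regret dominates the terms at 0 and n, while optimality caps it by the term at 0;
    -- so the term at n is nonpositive.
    have h2 := hs.sum_le_tsum {0, n} fun i _ => hr i
    rw [Finset.sum_pair (by omega)] at h2
    exact le_antisymm (by linarith) (hr n)
  · intro h0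
    refine ⟨?_, fun y hy => hy ⟨ψ, hψ, rfl⟩⟩
    rintro _ ⟨φ, hφ, rfl⟩
    obtain ⟨hs', he'⟩ := h.payoff_eq hc b φ hφ
    rw [he, he', tsum_eq_single 0 fun n hn => h0 n (by omega), h.meanRegret_zero,
      ← h.meanRegret_zero b c φ]
    linarith [hs'.le_tsum 0 fun i _ => h.meanRegret_nonneg hc b φ i]

end IsScoreSeq

end OptimalStopping

/-! ### Moments of the score from L¹ differentiability and the information bound. -/

section Regularity

variable {X : Type*} [MeasurableSpace X] {μ : Measure X}

/-- Multiply log √x ≥ 1 - 1/√x by 2x, which gives x log x ≥ 2x - 2√x. -/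
lemma sq_sqrt_sub_one_le_klFun {x : ℝ} (hx : 0 ≤ x) :
    (√x - 1) ^ 2 ≤ InformationTheory.klFun x := by
  rcases hx.eq_or_lt with rfl | hx
  · simp [InformationTheory.klFun_apply]
  · have hs := Real.sqrt_pos.2 hx
    have h1 := Real.one_sub_inv_le_log_of_pos hs
    have h2 := mul_le_mul_of_nonneg_left h1 (sq_nonneg √x)
    have h3 : √x ^ 2 * (1 - (√x)⁻¹) = √x ^ 2 - √x := by field_simp
    have h4 : Real.log √x = Real.log x / 2 := Real.log_sqrt hx.le
    rw [h3, h4, Real.sq_sqrt hx.le] at h2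
    rw [InformationTheory.klFun_apply]
    nlinarith [Real.sq_sqrt hx.le]

lemma isProbabilityMeasure_law {p : X → ℝ} (hp : ∫⁻ x, ENNReal.ofReal (p x) ∂μ = 1) :
    IsProbabilityMeasure (law μ p) :=
  ⟨by rw [law, withDensity_apply _ MeasurableSet.univ, Measure.restrict_univ, hp]⟩

/-- The squared Hellinger distance is at most the Kullback-Leibler divergence. -/
lemma lintegral_sq_sqrt_sub_le_klDiv [SigmaFinite μ] {p₀ p₁ : X → ℝ} (hm₀ : Measurable p₀)
    (hm₁ : Measurable p₁) (h₀ : ∀ x, 0 ≤ p₀ x) (h₁ : ∀ x, 0 ≤ p₁ x)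
    (hi₀ : ∫⁻ x, ENNReal.ofReal (p₀ x) ∂μ = 1) (hi₁ : ∫⁻ x, ENNReal.ofReal (p₁ x) ∂μ = 1) :
    ∫⁻ x, ENNReal.ofReal ((√(p₁ x) - √(p₀ x)) ^ 2) ∂μ ≤
      InformationTheory.klDiv (law μ p₀) (law μ p₁) := by
  have := isProbabilityMeasure_law hi₀
  have := isProbabilityMeasure_law hi₁
  by_cases hac : law μ p₀ ≪ law μ p₁
  swap
  · simp [InformationTheory.klDiv_of_not_ac hac]
  rw [InformationTheory.klDiv_eq_lintegral_klFun_of_ac hac]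
  set ρ := (law μ p₀).rnDeriv (law μ p₁) with hρ
  have hρm : Measurable ρ := Measure.measurable_rnDeriv _ _
  have hkm : Measurable fun x => ENNReal.ofReal (InformationTheory.klFun (ρ x).toReal) :=
    (InformationTheory.measurable_klFun.comp hρm.ennreal_toReal).ennreal_ofReal
  have h1 : (law μ p₁).withDensity ρ = law μ p₀ := Measure.withDensity_rnDeriv_eq _ _ hac
  -- Chain rule for densities. It holds μ-a.e., including on the zeros of p₁, where absolute
  -- continuity forces p₀ = 0.
  have h2 : (fun x => ENNReal.ofReal (p₁ x) * ρ x) =ᵐ[μ] fun x => ENNReal.ofReal (p₀ x) := by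
    rw [law, law, ← withDensity_mul _ hm₁.ennreal_ofReal hρm] at h1
    refine (withDensity_eq_iff (hm₁.ennreal_ofReal.mul hρm).aemeasurable
      hm₀.ennreal_ofReal.aemeasurable ?_).1 h1
    rw [← setLIntegral_univ, ← withDensity_apply _ MeasurableSet.univ, h1,
      withDensity_apply _ MeasurableSet.univ, setLIntegral_univ, hi₀]
    exact ENNReal.one_ne_top
  rw [law, lintegral_withDensity_eq_lintegral_mul _ hm₁.ennreal_ofReal hkm]
  refine lintegral_mono_ae ?_
  filter_upwards [h2] with x hx
  have h3 : p₁ x * (ρ x).toReal = p₀ x := by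
    have := congrArg ENNReal.toReal hx
    rwa [ENNReal.toReal_mul, ENNReal.toReal_ofReal (h₁ x), ENNReal.toReal_ofReal (h₀ x)] at this
  rw [Pi.mul_apply, ← ENNReal.ofReal_mul (h₁ x)]
  refine ENNReal.ofReal_le_ofReal ?_
  have h4 := mul_le_mul_of_nonneg_left
    (sq_sqrt_sub_one_le_klFun (ENNReal.toReal_nonneg (a := ρ x))) (h₁ x)
  have h5 : √(p₀ x) = √(p₁ x) * √(ρ x).toReal := by rw [← h3, Real.sqrt_mul (h₁ x)]
  calc (√(p₁ x) - √(p₀ x)) ^ 2 = √(p₁ x) ^ 2 * (√(ρ x).toReal - 1) ^ 2 := by rw [h5]; ring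
    _ ≤ _ := by rwa [Real.sq_sqrt (h₁ x)]

/-- A one-parameter family of densities which is differentiable in `L¹` at `θ₀`, with integrable
derivative `d`. -/
structure IsL1DiffFamily (μ : Measure X) (Θ : Set ℝ) (P : ℝ → X → ℝ) (θ₀ : ℝ) (d : X → ℝ) :
    Prop where
  measurable : ∀ θ ∈ Θ, Measurable (P θ)
  nonneg : ∀ θ ∈ Θ, ∀ x, 0 ≤ P θ x
  lintegral_eq_one : ∀ θ ∈ Θ, ∫⁻ x, ENNReal.ofReal (P θ x) ∂μ = 1
  mem_nhds : Θ ∈ 𝓝 θ₀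
  integrable_deriv : Integrable d μ
  isLittleO : (fun θ => ∫ x, |P θ x - P θ₀ x - (θ - θ₀) * d x| ∂μ) =o[𝓝 θ₀] fun θ => θ - θ₀

namespace IsL1DiffFamily

variable {Θ : Set ℝ} {P : ℝ → X → ℝ} {θ₀ : ℝ} {d : X → ℝ}

lemma mem (h : IsL1DiffFamily μ Θ P θ₀ d) : θ₀ ∈ Θ := mem_of_mem_nhds h.mem_nhds

lemma integrable (h : IsL1DiffFamily μ Θ P θ₀ d) {θ : ℝ} (hθ : θ ∈ Θ) : Integrable (P θ) μ := by
  refine ⟨(h.measurable θ hθ).aestronglyMeasurable, ?_⟩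
  rw [hasFiniteIntegral_iff_ofReal (ae_of_all _ (h.nonneg θ hθ)), h.lintegral_eq_one θ hθ]
  exact ENNReal.one_lt_top

lemma integral_eq_one (h : IsL1DiffFamily μ Θ P θ₀ d) {θ : ℝ} (hθ : θ ∈ Θ) :
    ∫ x, P θ x ∂μ = 1 := by
  rw [integral_eq_lintegral_of_nonneg_ae (ae_of_all _ (h.nonneg θ hθ))
    (h.measurable θ hθ).aestronglyMeasurable, h.lintegral_eq_one θ hθ, ENNReal.toReal_one]

lemma exists_ball (h : IsL1DiffFamily μ Θ P θ₀ d) : ∃ ε > 0, ∀ η, |η| < ε → θ₀ + η ∈ Θ := by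
  obtain ⟨ε, hε, hb⟩ := Metric.mem_nhds_iff.1 h.mem_nhds
  exact ⟨ε, hε, fun η hη => hb (by simpa [Real.dist_eq] using hη)⟩

lemma tendsto_integral_quotient (h : IsL1DiffFamily μ Θ P θ₀ d) {η : ℕ → ℝ}
    (hη : Tendsto η atTop (𝓝 0)) (hη0 : ∀ k, η k ≠ 0) :
    Tendsto (fun k => ∫ x, |(P (θ₀ + η k) x - P θ₀ x) / η k - d x| ∂μ) atTop (𝓝 0) := by
  have h1 : Tendsto (fun k => θ₀ + η k) atTop (𝓝 θ₀) := by simpa using hη.const_add θ₀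
  have h2 := (h.isLittleO.comp_tendsto h1).tendsto_div_nhds_zero.abs
  rw [abs_zero] at h2
  refine h2.congr fun k => ?_
  simp only [Function.comp_apply, add_sub_cancel_left]
  rw [abs_div, abs_of_nonneg (integral_nonneg fun _ => abs_nonneg _), ← integral_div]
  refine integral_congr_ae (ae_of_all _ fun x => ?_)
  simp only
  rw [← abs_div, sub_div, mul_div_cancel_left₀ _ (hη0 k)]

lemma exists_subseq_tendsto (h : IsL1DiffFamily μ Θ P θ₀ d) {η : ℕ → ℝ}
    (hη : Tendsto η atTop (𝓝 0)) (hη0 : ∀ k, η k ≠ 0) (hmem : ∀ k, θ₀ + η k ∈ Θ) :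
    ∃ φ : ℕ → ℕ, StrictMono φ ∧ ∀ᵐ x ∂μ,
      Tendsto (fun k => (P (θ₀ + η (φ k)) x - P θ₀ x) / η (φ k)) atTop (𝓝 (d x)) := by
  have hi : ∀ k, Integrable (fun x => (P (θ₀ + η k) x - P θ₀ x) / η k) μ := fun k =>
    ((h.integrable (hmem k)).sub (h.integrable h.mem)).div_const _
  refine TendstoInMeasure.exists_seq_tendsto_ae (tendstoInMeasure_of_tendsto_eLpNorm one_ne_zero
    (fun k => (hi k).1) h.integrable_deriv.1 ?_)
  have h1 := ENNReal.tendsto_ofReal (h.tendsto_integral_quotient hη hη0)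
  rw [ENNReal.ofReal_zero] at h1
  refine h1.congr fun k => ?_
  rw [eLpNorm_one_eq_lintegral_enorm,
    ← ofReal_integral_norm_eq_lintegral_enorm ((hi k).sub h.integrable_deriv)]
  rfl

/-- Both signs stay in Θ because `ae_deriv_eq_zero` compares right and left difference quotients. -/
lemma exists_seq (h : IsL1DiffFamily μ Θ P θ₀ d) {δ : ℝ} (hδ : 0 < δ) :
    ∃ η : ℕ → ℝ, Tendsto η atTop (𝓝 0) ∧ (∀ k, 0 < η k) ∧ (∀ k, η k ≤ δ) ∧
      (∀ k, θ₀ + η k ∈ Θ) ∧ ∀ k, θ₀ + -η k ∈ Θ := by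
  obtain ⟨ε, hε, hb⟩ := h.exists_ball
  have hm : 0 < min δ (ε / 2) := lt_min hδ (half_pos hε)
  have h1 : ∀ k : ℕ, min δ (ε / 2) * (1 / ((k : ℝ) + 1)) ≤ min δ (ε / 2) := fun k =>
    mul_le_of_le_one_right hm.le (by
      rw [div_le_one (by positivity)]
      linarith [(Nat.cast_nonneg k : (0 : ℝ) ≤ k)])
  have h0 : ∀ k : ℕ, 0 < min δ (ε / 2) * (1 / ((k : ℝ) + 1)) := fun k => by positivity
  have h2 : ∀ k : ℕ, |min δ (ε / 2) * (1 / ((k : ℝ) + 1))| < ε := fun k => by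
    rw [abs_of_pos (h0 k)]
    linarith [h1 k, min_le_right δ (ε / 2)]
  refine ⟨fun k => min δ (ε / 2) * (1 / ((k : ℝ) + 1)), ?_, h0,
    fun k => (h1 k).trans (min_le_left _ _), fun k => hb _ (h2 k), fun k => hb _ ?_⟩
  · simpa using (tendsto_one_div_add_atTop_nhds_zero_nat (𝕜 := ℝ)).const_mul (min δ (ε / 2))
  · rw [abs_neg]
    exact h2 k

/-- Difference quotients of probability densities integrate to zero and converge to d in L¹. -/
lemma integral_deriv (h : IsL1DiffFamily μ Θ P θ₀ d) : ∫ x, d x ∂μ = 0 := by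
  obtain ⟨η, hη, hpos, -, hmem, -⟩ := h.exists_seq one_pos
  have h1 := h.tendsto_integral_quotient hη fun k => (hpos k).ne'
  have h2 : |∫ x, d x ∂μ| ≤ 0 := by
    refine ge_of_tendsto h1 (Eventually.of_forall fun k => ?_)
    have h3 : ∫ x, ((P (θ₀ + η k) x - P θ₀ x) / η k - d x) ∂μ = -∫ x, d x ∂μ := by
      have hi : Integrable (fun x => (P (θ₀ + η k) x - P θ₀ x) / η k) μ :=
        ((h.integrable (hmem k)).sub (h.integrable h.mem)).div_const _
      rw [integral_sub hi h.integrable_deriv, integral_div,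
        integral_sub (h.integrable (hmem k)) (h.integrable h.mem), h.integral_eq_one (hmem k),
        h.integral_eq_one h.mem]
      simp
    rw [← abs_neg, ← h3]
    exact abs_integral_le_integral_abs
  exact abs_eq_zero.1 (le_antisymm h2 (abs_nonneg _))

/-- At a zero of the null density θ₀ minimizes a nonnegative function of θ: right quotients are
nonnegative, left ones nonpositive. Thus dividing d by the density loses none of its mass. -/
lemma ae_deriv_eq_zero (h : IsL1DiffFamily μ Θ P θ₀ d) : ∀ᵐ x ∂μ, P θ₀ x = 0 → d x = 0 := by
  obtain ⟨η, hη, hpos, -, hmem, hmem'⟩ := h.exists_seq one_pos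
  obtain ⟨φ, -, h1⟩ := h.exists_subseq_tendsto hη (fun k => (hpos k).ne') hmem
  have hη' : Tendsto (fun k => -η k) atTop (𝓝 0) := by simpa using hη.neg
  obtain ⟨φ', -, h2⟩ := h.exists_subseq_tendsto hη' (fun k => (neg_neg_of_pos (hpos k)).ne) hmem'
  filter_upwards [h1, h2] with x hx hx' h0
  refine le_antisymm (le_of_tendsto hx' (Eventually.of_forall fun k => ?_))
    (ge_of_tendsto hx (Eventually.of_forall fun k => ?_))
  · rw [h0, sub_zero]
    exact div_nonpos_of_nonneg_of_nonpos (h.nonneg _ (hmem' _) x) (neg_nonpos.2 (hpos _).le)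
  · rw [h0, sub_zero]
    exact div_nonneg (h.nonneg _ (hmem _) x) (hpos _).le

/-- A quadratic bound on the information yields a bound on the Fisher information. -/
lemma lintegral_sq_div_le [SigmaFinite μ] (h : IsL1DiffFamily μ Θ P θ₀ d) {δ γ : ℝ} (hδ : 0 < δ)
    (hkl : ∀ θ ∈ Θ, |θ - θ₀| ≤ δ →
      InformationTheory.klDiv (law μ (P θ₀)) (law μ (P θ)) ≤
        ENNReal.ofReal (γ * (θ - θ₀) ^ 2)) :
    ∫⁻ x, ENNReal.ofReal (d x ^ 2 / (4 * P θ₀ x)) ∂μ ≤ ENNReal.ofReal γ := by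
  obtain ⟨η, hη, hpos, hle, hmem, -⟩ := h.exists_seq hδ
  obtain ⟨φ, hφ, hlim⟩ := h.exists_subseq_tendsto hη (fun k => (hpos k).ne') hmem
  have hηφ := hη.comp hφ.tendsto_atTop
  -- Squared difference quotients of √P: the Hellinger bound keeps their integrals below γ, and
  -- where P θ₀ > 0 they converge a.e. to d² / (4 P θ₀), so Fatou applies.
  let G : ℕ → X → ℝ≥0∞ := fun k x =>
    ENNReal.ofReal (((√(P (θ₀ + η (φ k)) x) - √(P θ₀ x)) / η (φ k)) ^ 2)
  have hGm : ∀ k, Measurable (G k) := fun k =>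
    (((((h.measurable _ (hmem (φ k))).sqrt).sub (h.measurable _ h.mem).sqrt).div_const _).pow_const
      2).ennreal_ofReal
  have hGi : ∀ k, ∫⁻ x, G k x ∂μ ≤ ENNReal.ofReal γ := by
    intro k
    have hp := hpos (φ k)
    have h1 := (lintegral_sq_sqrt_sub_le_klDiv (h.measurable _ h.mem)
      (h.measurable _ (hmem (φ k))) (h.nonneg _ h.mem) (h.nonneg _ (hmem (φ k)))
      (h.lintegral_eq_one _ h.mem) (h.lintegral_eq_one _ (hmem (φ k)))).trans
      (hkl _ (hmem (φ k)) (by rw [add_sub_cancel_left, abs_of_pos hp]; exact hle _))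
    rw [add_sub_cancel_left] at h1
    have h2 : ∀ x, G k x = ENNReal.ofReal ((η (φ k) ^ 2)⁻¹) *
        ENNReal.ofReal ((√(P (θ₀ + η (φ k)) x) - √(P θ₀ x)) ^ 2) := by
      intro x
      simp only [G]
      rw [← ENNReal.ofReal_mul (by positivity), div_pow, div_eq_inv_mul]
    simp_rw [h2]
    rw [lintegral_const_mul' _ _ ENNReal.ofReal_ne_top]
    calc _ ≤ ENNReal.ofReal ((η (φ k) ^ 2)⁻¹) * ENNReal.ofReal (γ * η (φ k) ^ 2) := by gcongr
      _ = ENNReal.ofReal γ := by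
        rw [← ENNReal.ofReal_mul (by positivity)]
        congr 1
        field_simp
  calc ∫⁻ x, ENNReal.ofReal (d x ^ 2 / (4 * P θ₀ x)) ∂μ
      ≤ ∫⁻ x, liminf (fun k => G k x) atTop ∂μ := by
        refine lintegral_mono_ae ?_
        filter_upwards [hlim] with x hx
        rcases (h.nonneg _ h.mem x).eq_or_lt with h0 | h0
        -- Division by zero yields 0 on the left, so nothing is required at zeros of the density.
        · simp [← h0]
        have h3 : Tendsto (fun k => P (θ₀ + η (φ k)) x) atTop (𝓝 (P θ₀ x)) := by
          have h4 := (hx.mul hηφ).add_const (P θ₀ x)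
          rw [mul_zero, zero_add] at h4
          refine h4.congr fun k => ?_
          rw [Function.comp_apply, div_mul_cancel₀ _ (hpos _).ne', sub_add_cancel]
        have h5 : Tendsto (fun k => √(P (θ₀ + η (φ k)) x) + √(P θ₀ x)) atTop
            (𝓝 (√(P θ₀ x) + √(P θ₀ x))) :=
          ((Real.continuous_sqrt.tendsto _).comp h3).add_const _
        have hs := Real.sqrt_pos.2 h0
        have h6 := ((hx.div h5 (by positivity)).pow 2)
        have h7 : (d x / (√(P θ₀ x) + √(P θ₀ x))) ^ 2 = d x ^ 2 / (4 * P θ₀ x) := by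
          rw [div_pow, ← two_mul, mul_pow, Real.sq_sqrt h0.le]
          norm_num
        rw [h7] at h6
        refine (Tendsto.liminf_eq ((ENNReal.tendsto_ofReal h6).congr fun k => ?_)).ge
        simp only [G]
        congr 2
        have hsum : √(P (θ₀ + η (φ k)) x) + √(P θ₀ x) ≠ 0 := by
          have := Real.sqrt_nonneg (P (θ₀ + η (φ k)) x)
          positivity
        have h8 : P (θ₀ + η (φ k)) x - P θ₀ x =
            (√(P (θ₀ + η (φ k)) x) - √(P θ₀ x)) * (√(P (θ₀ + η (φ k)) x) + √(P θ₀ x)) := by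
          have e1 := Real.sq_sqrt (h.nonneg _ (hmem (φ k)) x)
          have e2 := Real.sq_sqrt h0.le
          nlinarith
        simp only [Pi.div_apply]
        rw [h8]
        have := (hpos (φ k)).ne'
        field_simp
    _ ≤ liminf (fun k => ∫⁻ x, G k x ∂μ) atTop := lintegral_liminf_le hGm
    _ ≤ ENNReal.ofReal γ :=
        liminf_le_of_frequently_le' (Frequently.of_forall hGi)

end IsL1DiffFamily

lemma lintegral_law {p : X → ℝ} (hp : Measurable p) (F : X → ℝ≥0∞) (hF : Measurable F) :
    ∫⁻ x, F x ∂law μ p = ∫⁻ x, ENNReal.ofReal (p x) * F x ∂μ := by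
  rw [law, lintegral_withDensity_eq_lintegral_mul _ hp.ennreal_ofReal hF]
  rfl

lemma integral_law {p : X → ℝ} (hp : Measurable p) (h0 : ∀ x, 0 ≤ p x) (F : X → ℝ) :
    ∫ x, F x ∂law μ p = ∫ x, F x * p x ∂μ := by
  rw [law, integral_withDensity_eq_integral_toReal_smul hp.ennreal_ofReal
    (ae_of_all _ fun _ => ENNReal.ofReal_lt_top)]
  refine integral_congr_ae (ae_of_all _ fun x => ?_)
  simp [ENNReal.toReal_ofReal (h0 x), mul_comm]

/-- The normalized `L¹` derivative is centred and has a second moment controlled by the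
information. -/
lemma IsL1DiffFamily.score_moments [SigmaFinite μ] {Θ : Set ℝ} {P : ℝ → X → ℝ} {θ₀ : ℝ}
    {d : X → ℝ} (h : IsL1DiffFamily μ Θ P θ₀ d) (hd : Measurable d) {δ γ : ℝ} (hδ : 0 < δ)
    (hγ : 0 < γ)
    (hkl : ∀ θ ∈ Θ, |θ - θ₀| ≤ δ →
      InformationTheory.klDiv (law μ (P θ₀)) (law μ (P θ)) ≤
        ENNReal.ofReal (γ * (θ - θ₀) ^ 2)) :
    MemLp (fun x => d x / P θ₀ x) 2 (law μ (P θ₀)) ∧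
      ∫ x, d x / P θ₀ x ∂law μ (P θ₀) = 0 ∧
      ∫ x, (d x / P θ₀ x) ^ 2 ∂law μ (P θ₀) ≤ 4 * γ := by
  have hp := h.measurable _ h.mem
  have h0 := h.nonneg _ h.mem
  have hq : Measurable fun x => d x / P θ₀ x := hd.div hp
  have hl : ∫⁻ x, ENNReal.ofReal ((d x / P θ₀ x) ^ 2) ∂law μ (P θ₀) ≤
      ENNReal.ofReal (4 * γ) := by
    rw [lintegral_law hp _ (hq.pow_const 2).ennreal_ofReal,
      ENNReal.ofReal_mul (by norm_num : (0 : ℝ) ≤ 4)]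
    refine le_trans (le_of_eq ?_) (mul_le_mul_right (h.lintegral_sq_div_le hδ hkl) _)
    rw [← lintegral_const_mul' _ _ ENNReal.ofReal_ne_top]
    refine lintegral_congr fun x => ?_
    rw [← ENNReal.ofReal_mul (h0 x), ← ENNReal.ofReal_mul (by norm_num)]
    congr 1
    rcases (h0 x).eq_or_lt with hx | hx
    · simp [← hx]
    · field_simp
  have hi : Integrable (fun x => (d x / P θ₀ x) ^ 2) (law μ (P θ₀)) := by
    refine ⟨(hq.pow_const 2).aestronglyMeasurable, ?_⟩
    rw [hasFiniteIntegral_iff_ofReal (ae_of_all _ fun x => sq_nonneg _)]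
    exact hl.trans_lt ENNReal.ofReal_lt_top
  refine ⟨(memLp_two_iff_integrable_sq hq.aestronglyMeasurable).2 hi, ?_, ?_⟩
  · rw [integral_law hp h0, ← h.integral_deriv]
    refine integral_congr_ae ?_
    filter_upwards [h.ae_deriv_eq_zero] with x hx
    by_cases hx0 : P θ₀ x = 0
    · rw [hx0, mul_zero, hx hx0]
    · exact div_mul_cancel₀ _ hx0
  · rw [integral_eq_lintegral_of_nonneg_ae (ae_of_all _ fun x => sq_nonneg _) hi.1]
    exact ENNReal.toReal_le_of_le_ofReal (by positivity) hl

end Regularity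

/-! ### From densities with respect to μ to laws of observations. -/

section Bridge

variable {X : Type*} [MeasurableSpace X] {μ : Measure X}

/-- A sequence of probability densities with respect to `μ`. -/
structure IsDensitySeq (μ : Measure X) (p : ℕ → X → ℝ) : Prop where
  measurable : ∀ j, Measurable (p j)
  nonneg : ∀ j x, 0 ≤ p j x
  lintegral_eq_one : ∀ j, ∫⁻ x, ENNReal.ofReal (p j x) ∂μ = 1

namespace IsDensitySeq

variable {p : ℕ → X → ℝ}

lemma isProb (hp : IsDensitySeq μ p) (j : ℕ) : IsProbabilityMeasure (law μ (p j)) :=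
  isProbabilityMeasure_law (hp.lintegral_eq_one j)

lemma measurable_jointDensity (hp : IsDensitySeq μ p) (n : ℕ) :
    Measurable (jointDensity p n) :=
  Finset.measurable_prod _ fun i _ => (hp.measurable i).comp (measurable_pi_apply i)

lemma jointDensity_nonneg (hp : IsDensitySeq μ p) (n : ℕ) (x : Fin n → X) :
    0 ≤ jointDensity p n x :=
  Finset.prod_nonneg fun _ _ => hp.nonneg _ _

/-- The joint law of independent observations has the joint density. -/
lemma pathLaw_law [SigmaFinite μ] (hp : IsDensitySeq μ p) (n : ℕ) :
    pathLaw (fun j => law μ (p j)) n = law (prodMeasure μ n) (jointDensity p n) := by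
  have := hp.isProb
  refine Measure.pi_eq fun s hs => ?_
  have hpi : MeasurableSet (Set.univ.pi s) := MeasurableSet.univ_pi hs
  have hint : ∀ i : Fin n, Integrable ((s i).indicator (p i)) μ := fun i => by
    refine Integrable.indicator ⟨(hp.measurable i).aestronglyMeasurable, ?_⟩ (hs i)
    rw [hasFiniteIntegral_iff_ofReal (ae_of_all _ (hp.nonneg i)), hp.lintegral_eq_one]
    exact ENNReal.one_lt_top
  have hnn : ∀ (i : Fin n) x, 0 ≤ (s i).indicator (p i) x := fun i x =>
    Set.indicator_nonneg (fun _ _ => hp.nonneg i _) x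
  have h1 : ∀ i : Fin n, law μ (p i) (s i) =
      ENNReal.ofReal (∫ x, (s i).indicator (p i) x ∂μ) := fun i => by
    rw [law, withDensity_apply _ (hs i), ofReal_integral_eq_lintegral_ofReal (hint i)
      (ae_of_all _ (hnn i)), ← lintegral_indicator (hs i)]
    refine lintegral_congr fun x => ?_
    by_cases hx : x ∈ s i <;> simp [hx]
  -- On a box the restricted joint density is a product of one-variable functions, so its integral
  -- factorizes; boxes determine the product measure.
  have h2 : ∀ x, (Set.univ.pi s).indicator (fun x => ENNReal.ofReal (jointDensity p n x)) x =
      ENNReal.ofReal (∏ i : Fin n, (s i).indicator (p i) (x i)) := by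
    intro x
    by_cases hx : x ∈ Set.univ.pi s
    · rw [Set.indicator_of_mem hx, jointDensity]
      congr 1
      exact Finset.prod_congr rfl fun i _ => (Set.indicator_of_mem (hx i trivial) _).symm
    · rw [Set.indicator_of_notMem hx]
      simp only [Set.mem_pi, Set.mem_univ, forall_const, not_forall] at hx
      obtain ⟨i, hi⟩ := hx
      rw [Finset.prod_eq_zero (Finset.mem_univ i) (Set.indicator_of_notMem hi _),
        ENNReal.ofReal_zero]
  rw [law, withDensity_apply _ hpi, ← lintegral_indicator hpi]
  simp_rw [h2]
  rw [prodMeasure, ← ofReal_integral_eq_lintegral_ofReal (Integrable.fintype_prod_dep hint)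
    (ae_of_all _ fun x => Finset.prod_nonneg fun i _ => hnn i _),
    integral_fintype_prod_eq_prod,
    ENNReal.ofReal_prod_of_nonneg fun i _ => integral_nonneg (hnn i)]
  exact Finset.prod_congr rfl fun i _ => (h1 i).symm

lemma expect_eq [SigmaFinite μ] (hp : IsDensitySeq μ p) (n : ℕ) (F : (Fin n → X) → ℝ) :
    expect μ p n F = ∫ x, F x ∂pathLaw (fun j => law μ (p j)) n := by
  rw [hp.pathLaw_law, integral_law (hp.measurable_jointDensity n) (hp.jointDensity_nonneg n)]
  rfl

lemma ae_pathLaw_iff [SigmaFinite μ] (hp : IsDensitySeq μ p) {n : ℕ}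
    {Q : (Fin n → X) → Prop} :
    (∀ᵐ x ∂pathLaw (fun j => law μ (p j)) n, Q x) ↔
      ∀ᵐ x ∂prodMeasure μ n, 0 < jointDensity p n x → Q x := by
  rw [hp.pathLaw_law, law, ae_withDensity_iff (hp.measurable_jointDensity n).ennreal_ofReal]
  simp only [ne_eq, ENNReal.ofReal_eq_zero, not_le]

variable {fdot q : ℕ → X → ℝ} {K c : ℝ}

lemma stopProb_eq [SigmaFinite μ] (hp : IsDensitySeq μ p) (ψ : StoppingRule X) (n : ℕ) :
    stopProb μ p ψ n = ENNReal.ofReal (halt (fun j => law μ (p j)) ψ n) := by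
  have := hp.isProb
  have : IsProbabilityMeasure (pathLaw (fun j => law μ (p j)) n) := by
    unfold pathLaw
    infer_instance
  have hi : Integrable (ψ.s n) (pathLaw (fun j => law μ (p j)) n) := by
    simpa using ψ.integrable_s_mul (integrable_const (1 : ℝ))
  rw [halt, ofReal_integral_eq_lintegral_ofReal hi (ae_of_all _ (ψ.s_nonneg n)), hp.pathLaw_law,
    lintegral_law (hp.measurable_jointDensity n) _ (ψ.measurable_s n).ennreal_ofReal]
  refine lintegral_congr fun x => ?_
  rw [← ENNReal.ofReal_mul (hp.jointDensity_nonneg n x), mul_comm]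

lemma mem_finiteASN_iff [SigmaFinite μ] (hp : IsDensitySeq μ p)
    (h : IsScoreSeq (fun j => law μ (p j)) q K) (ψ : StoppingRule X) :
    ψ ∈ finiteASN μ p ↔ Summable (reach (fun j => law μ (p j)) ψ) := by
  simp only [finiteASN, Set.mem_ofPred_eq, asn, hp.stopProb_eq]
  exact mean_lt_top_iff_summable_tail (IsScoreSeq.reach_nonneg ψ) (IsScoreSeq.halt_nonneg ψ)
    (h.reach_succ ψ) (h.reach_zero ψ)

/-- The score is only a.e. equal to a measurable q; coordinate projections pull μ-null sets back to
null sets of the product. -/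
lemma ae_centred [SigmaFinite μ] (hp : IsDensitySeq μ p)
    (hq : ∀ j, score p fdot j =ᵐ[μ] q j) (b : ℝ) (n : ℕ) :
    ∀ᵐ x ∂pathLaw (fun j => law μ (p j)) n,
      b - ∑ i : Fin n, score p fdot i (x i) = centred q b n x := by
  refine hp.ae_pathLaw_iff.2 ?_
  have h1 : ∀ᵐ x ∂prodMeasure μ n, ∀ i : Fin n, score p fdot i (x i) = q i (x i) :=
    ae_all_iff.2 fun i =>
      (Measure.quasiMeasurePreserving_eval (fun _ : Fin n => μ) i).ae (hq i)
  filter_upwards [h1] with x hx _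
  simp only [centred, hx]

lemma lagrangian_eq [SigmaFinite μ] (hp : IsDensitySeq μ p)
    (hq : ∀ j, score p fdot j =ᵐ[μ] q j) (b c : ℝ) (ψ : StoppingRule X) :
    lagrangian μ p fdot b c ψ = payoff (fun j => law μ (p j)) q b c ψ := by
  refine tsum_congr fun n => ?_
  rw [hp.expect_eq]
  refine integral_congr_ae ?_
  filter_upwards [hp.ae_centred hq b n] with x hx
  rw [hx]

lemma integral_score_eq (hp : IsDensitySeq μ p) (hq : ∀ j, score p fdot j =ᵐ[μ] q j)
    (F : ℝ → ℝ) (n : ℕ) (z : ℝ) :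
    ∫ x, F (z - score p fdot n x) * p n x ∂μ = ∫ x, F (z - q n x) ∂law μ (p n) := by
  rw [integral_law (hp.measurable n) (hp.nonneg n)]
  refine integral_congr_ae ?_
  filter_upwards [hq n] with x hx
  rw [hx]

lemma backward_eq (hp : IsDensitySeq μ p) (hq : ∀ j, score p fdot j =ᵐ[μ] q j) (c : ℝ) (k : ℕ) :
    ∀ n, backward μ p fdot c k n = truncVal (fun j => law μ (p j)) q c k n := by
  induction k with
  | zero => exact fun n => rfl
  | succ k ih =>
    intro n
    funext z
    simp only [backward, truncVal]
    rw [hp.integral_score_eq hq, ih]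

/-- The limit exists and is finite, so `limUnder` takes its genuine value. Truncated subtraction in
N - (n + 1) affects only finitely many N. -/
lemma r_eq (hp : IsDensitySeq μ p) (hq : ∀ j, score p fdot j =ᵐ[μ] q j)
    (h : IsScoreSeq (fun j => law μ (p j)) q K) (hc : 0 < c) (n : ℕ) (z : ℝ) :
    r μ p fdot c n z = (contVal (fun j => law μ (p j)) q c n z : EReal) := by
  have h1 : ∀ N, rTrunc μ p fdot c N n z =
      ∫ x, truncVal (fun j => law μ (p j)) q c (N - (n + 1)) (n + 1) (z - q n x)
        ∂law μ (p n) := by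
    intro N
    rw [rTrunc, hp.integral_score_eq hq]
    simp only [vTrunc, hp.backward_eq hq]
  refine Tendsto.limUnder_eq (EReal.tendsto_coe.2 ?_)
  simp_rw [h1]
  exact (h.tendsto_integral_truncVal hc n z).comp (tendsto_sub_atTop_nat (n + 1))

/-- A rule makes no regrettable decision iff it stops where stopping is strictly better and
continues where continuing is strictly better. -/
lemma regret_eq_zero_iff_indicator (hp : IsDensitySeq μ p)
    (hq : ∀ j, score p fdot j =ᵐ[μ] q j)
    (h : IsScoreSeq (fun j => law μ (p j)) q K) (hc : 0 < c) (b : ℝ) (ψ : StoppingRule X) {n : ℕ}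
    {x : Fin n → X} (hx : 0 < jointDensity p n x)
    (hz : b - ∑ i : Fin n, score p fdot i (x i) = centred q b n x) :
    regret (fun j => law μ (p j)) q b c ψ n x = 0 ↔
      (mustStop μ p fdot b c n).indicator 1 x ≤ ψ.prob n x ∧
        ψ.prob n x ≤ (mayStop μ p fdot b c n).indicator 1 x := by
  have hstat : b - zStat p fdot n x = centred q b n x := by
    rw [← hz, zStat, if_neg hx.ne']
  have hmust : x ∈ mustStop μ p fdot b c n ↔ g (centred q b n x) <
      c + contVal (fun j => law μ (p j)) q c n (centred q b n x) := by
    simp only [mustStop, Set.mem_ofPred_eq, hstat, hp.r_eq hq h hc]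
    exact_mod_cast Iff.rfl
  have hmay : x ∈ mayStop μ p fdot b c n ↔ ¬ (c + contVal (fun j => law μ (p j)) q c n
      (centred q b n x) < g (centred q b n x)) := by
    simp only [mayStop, Set.mem_ofPred_eq, hstat, hp.r_eq hq h hc, not_lt]
    exact_mod_cast Iff.rfl
  rw [h.regret_eq_zero_iff hc, ← hmust, ← not_iff_comm.1 hmay.symm]
  have h0 := ψ.nonneg n x
  have h1 := ψ.le_one n x
  refine and_congr ?_ ?_
  · by_cases hm : x ∈ mustStop μ p fdot b c n
    · simp [hm, h1.ge_iff_eq', eq_comm]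
    · simp [hm, h0]
  · by_cases hm : x ∈ mayStop μ p fdot b c n
    · simp [hm, h1]
    · simp [hm, h0.ge_iff_eq']

end IsDensitySeq

end Bridge

end SeqTest

/-! ### The criterion in the statistical model. -/

theorem theorem4 {X : Type*} [MeasurableSpace X] (μ : Measure X) [SigmaFinite μ]
    (Θ : Set ℝ) (hΘ : IsOpen Θ) (θ₀ : ℝ) (hθ₀ : θ₀ ∈ Θ)
    (f : ℝ → ℕ → X → ℝ) (hf : SeqTest.IsDensityFamily μ Θ f)
    (fdot : ℕ → X → ℝ)
    (h1 : SeqTest.KLQuadraticBound μ Θ f θ₀)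
    (h2 : SeqTest.L1Differentiable μ f θ₀ fdot)
    (h3 : SeqTest.ScoreMomentBound μ (f θ₀) fdot)
    (b c : ℝ) (hc : 0 < c)
    (ψ : SeqTest.StoppingRule X) (hψ : ψ ∈ SeqTest.finiteASN μ (f θ₀)) :
    IsGLB (SeqTest.lagrangian μ (f θ₀) fdot b c '' SeqTest.finiteASN μ (f θ₀))
        (SeqTest.lagrangian μ (f θ₀) fdot b c ψ) ↔
      ∀ n : ℕ, 1 ≤ n → ∀ᵐ x ∂(SeqTest.prodMeasure μ n),
        x ∈ ψ.T n ∩ {x | 0 < SeqTest.jointDensity (f θ₀) n x} →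
          (SeqTest.mustStop μ (f θ₀) fdot b c n).indicator 1 x ≤ ψ.prob n x ∧
          ψ.prob n x ≤ (SeqTest.mayStop μ (f θ₀) fdot b c n).indicator 1 x := by
  have hp : SeqTest.IsDensitySeq μ (f θ₀) :=
    ⟨hf.measurable θ₀ hθ₀, hf.nonneg θ₀ hθ₀, hf.lintegral_eq_one θ₀ hθ₀⟩
  obtain ⟨δ, hδ, γ, hγ, hkl⟩ := h1
  -- Integrability makes the derivative measurable only up to a null set, so a measurable
  -- representative is used.
  let d : ℕ → X → ℝ := fun j => (h2 j).1.1.mk (fdot j)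
  have hdm : ∀ j, Measurable (d j) := fun j => (h2 j).1.1.stronglyMeasurable_mk.measurable
  have hd : ∀ j, fdot j =ᵐ[μ] d j := fun j => (h2 j).1.1.ae_eq_mk
  let q : ℕ → X → ℝ := fun j x => d j x / f θ₀ j x
  have hq : ∀ j, SeqTest.score (f θ₀) fdot j =ᵐ[μ] q j := fun j => by
    filter_upwards [hd j] with x hx
    simp only [SeqTest.score, q, hx]
  have hfam : ∀ j, SeqTest.IsL1DiffFamily μ Θ (fun θ => f θ j) θ₀ (d j) := fun j =>
    { measurable := fun θ hθ => hf.measurable θ hθ j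
      nonneg := fun θ hθ => hf.nonneg θ hθ j
      lintegral_eq_one := fun θ hθ => hf.lintegral_eq_one θ hθ j
      mem_nhds := hΘ.mem_nhds hθ₀
      integrable_deriv := (h2 j).1.congr (hd j)
      isLittleO := (h2 j).2.congr_left fun θ => integral_congr_ae (by
        filter_upwards [hd j] with x hx
        rw [hx]) }
  have hmom := fun j => (hfam j).score_moments (hdm j) hδ hγ (hkl j)
  have h : SeqTest.IsScoreSeq (fun j => SeqTest.law μ (f θ₀ j)) q (4 * γ) :=
    ⟨hp.isProb, fun j => (hdm j).div (hp.measurable j), fun j => (hmom j).1,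
      fun j => (hmom j).2.1, fun j => (hmom j).2.2⟩
  have hF : SeqTest.finiteASN μ (f θ₀) =
      {φ | Summable (SeqTest.reach (fun j => SeqTest.law μ (f θ₀ j)) φ)} :=
    Set.ext fun φ => hp.mem_finiteASN_iff h φ
  rw [hF, funext (hp.lagrangian_eq hq b c), h.isGLB_payoff_iff hc b ψ
    ((hp.mem_finiteASN_iff h ψ).1 hψ)]
  refine forall₂_congr fun n _ => ?_
  rw [h.meanRegret_eq_zero_iff hc, hp.ae_pathLaw_iff]
  have hz := hp.ae_pathLaw_iff.1 (hp.ae_centred hq b n)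
  refine eventually_congr ?_
  filter_upwards [hz] with x hx
  constructor
  · rintro hr ⟨ht, hj⟩
    exact (hp.regret_eq_zero_iff_indicator hq h hc b ψ hj (hx hj)).1 (hr hj ht)
  · intro hr hj ht
    exact (hp.regret_eq_zero_iff_indicator hq h hc b ψ hj (hx hj)).2 (hr ⟨ht, hj⟩)
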